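/- All polynomials have complex coefficients and lie in $\mathbb{S}=\mathbb{C}[x_1,x_2,\ldots]$. \textbf{Bounds and p-families.} A sequence $(c_n)_{n\in\mathbb{N}}$ of natural numbers is polynomially bounded if there is a polynomial $t$ with $c_n\le t(n)$ for all $n$, and quasipolynomially bounded if there is a polynomial $q$ with $c_n\le n^{q(\log_2 n)}$ for all $n\ge 2$. A p-family is a sequence $(f_n)_{n\in\mathbb{N}}$ in $\mathbb{S}$ such that $\deg f_n$ and the number of variables occurring in $f_n$ are polynomially bounded. \textbf{Classes.} An algebraic circuit is a directed acyclic graph whose sources are labelled by affine linear polynomials and whose other vertices are labelled by $+$ or $\times$ (of arity two); it is a formula if the graph is a tree. Its size is its number of vertices. The permanental complexity of $f$ is the smallest $n$ such that $f$ is the permanent of an $n\times n$ matrix with affine linear entries. $\mathsf{VF}$, $\mathsf{VNP}$, $\mathsf{VQP}$ are the classes of p-families with polynomially bounded formula size, polynomially bounded permanental complexity, and quasipolynomially bounded circuit size, respectively. A polynomial has border formula (circuit) size at most $s$ if it is a limit, in the Euclidean topology on the coefficient space, of polynomials of formula (circuit) size at most $s$. $\overline{\mathsf{VF}}$ and $\overline{\mathsf{VQP}}$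 are the classes of p-families with polynomially bounded border formula size and quasipolynomially bounded border circuit size, respectively. \textbf{Reductions.} Let $p,q$ each be zero or homogeneous of degree $d$. If $d>0$, write $p\le_{\mathrm{homlin}}q$ if $p$ arises from $q$ by replacing its variables by homogeneous linear polynomials, and $p\trianglelefteq_{\mathrm{homlin}}q$ if $p$ is a limit of polynomials that arise from $q$ in this way. If $d=0$, both relations hold by convention for every $p$ and every nonzero $q$. For families $f=(f_{n,d})$ and $h=(h_{n,d})$, $n,d\in\mathbb{N}$, of such polynomials, write $f\le_{\text{p-homlin}}h$ if there is a polynomially bounded $m$ with $f_{n,d}\le_{\mathrm{homlin}}h_{m_n,d}$ for all $n,d$; define $f\trianglelefteq_{\text{p-homlin}}h$ likewise with $\trianglelefteq_{\mathrm{homlin}}$, and $\le_{\text{qp-homlin}}$, $\trianglelefteq_{\text{qp-homlin}}$ likewise with $m$ only quasipolynomially bounded. \textbf{Families.} Let $\mathrm{per}_{n,d}$ be the homogeneous component of degree $d$ of the permanent of the $n\times n$ matrix of variables (so $\mathrm{per}_{n,d}=0$ for $d\ne n$). Let $A_1,\ldots,A_n$ be $3\times3$ matrices whose $9n$ entries are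 distinct variables, and let $\mathsf{nc}e_{3,n,d}$ be the sum of all nine entries of the matrix $\sum_{1\le I_1<\cdots<I_d\le n}A_{I_1}A_{I_2}\cdots A_{I_d}$. Write $\mathsf{nc}e_3$ for the family $(\mathsf{nc}e_{3,n,d})_{n,d}$. \textbf{Theorem.} \begin{enumerate} \item $\mathsf{VNP}=\mathsf{VF}$ if and only if $\mathrm{per}\le_{\text{p-homlin}}\mathsf{nc}e_3$. \item $\mathsf{VNP}\subseteq\overline{\mathsf{VF}}$ if and only if $\mathrm{per}\trianglelefteq_{\text{p-homlin}}\mathsf{nc}e_3$. \item $\mathsf{VNP}\subseteq\mathsf{VQP}$ if and only if $\mathrm{per}\le_{\text{qp-homlin}}\mathsf{nc}e_3$. \item $\mathsf{VNP}\subseteq\overline{\mathsf{VQP}}$ if and only if $\mathrm{per}\trianglelefteq_{\text{qp-homlin}}\mathsf{nc}e_3$. \end{enumerate} -/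

import Mathlib

namespace AlgComplexity

open MvPolynomial Filter Topology

/-- The ring of complex polynomials in countably many variables. -/
abbrev Poly : Type := MvPolynomial ℕ ℂ

/-! ### Growth bounds -/

/-- Polynomially bounded sequences of natural numbers. -/
def PolyBounded : Set (ℕ → ℕ) :=
  {c | ∃ t : Polynomial ℝ, ∀ n : ℕ, (c n : ℝ) ≤ t.eval (n : ℝ)}

/-- Quasipolynomially bounded sequences: `c n ≤ n ^ q(log₂ n)` for all `n ≥ 2`, `q` a polynomial. -/
def QuasiPolyBounded : Set (ℕ → ℕ) :=
  {c | ∃ q : Polynomial ℝ, ∀ n : ℕ, 2 ≤ n →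
    (c n : ℝ) ≤ (n : ℝ) ^ (q.eval (Real.logb 2 (n : ℝ)))}

/-- (Ungraded) p-families: degree and number of occurring variables are polynomially bounded. -/
def PFamilies : Set (ℕ → Poly) :=
  {f | (fun n => (f n).totalDegree) ∈ PolyBounded ∧ (fun n => (f n).vars.card) ∈ PolyBounded}

/-! ### Formulas -/

/-- Algebraic formulas; leaves are labelled by affine linear polynomials. -/
inductive Formula : Type
  | leaf (l : Poly) (hl : l.totalDegree ≤ 1) : Formula
  | add (F G : Formula) : Formula
  | mul (F G : Formula) : Formula

/-- The polynomial computed by a formula. -/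
noncomputable def Formula.eval : Formula → Poly
  | .leaf l _ => l
  | .add F G => F.eval + G.eval
  | .mul F G => F.eval * G.eval

/-- The number of vertices of a formula. -/
def Formula.size : Formula → ℕ
  | .leaf _ _ => 1
  | .add F G => F.size + G.size + 1
  | .mul F G => F.size + G.size + 1

/-- Polynomials of formula size at most `s`. -/
def formulaSizeLE (s : ℕ) : Set Poly :=
  {p | ∃ F : Formula, F.size ≤ s ∧ F.eval = p}

/-! ### Circuits -/

/-- The label of a vertex of a circuit that is preceded by `n` vertices. -/
inductive Gate (n : ℕ) : Type
  | input (l : Poly) (hl : l.totalDegree ≤ 1) : Gate n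
  | add (i j : Fin n) : Gate n
  | mul (i j : Fin n) : Gate n

/-- Algebraic circuits with `n` vertices, the vertices being listed in a topological order of the
underlying acyclic directed graph. -/
inductive Circuit : ℕ → Type
  | nil : Circuit 0
  | snoc {n : ℕ} (C : Circuit n) (g : Gate n) : Circuit (n + 1)

/-- The polynomial computed at a vertex, from the polynomials computed at the earlier vertices. -/
noncomputable def Gate.eval {n : ℕ} (v : Fin n → Poly) : Gate n → Poly
  | .input l _ => l
  | .add i j => v i + v j
  | .mul i j => v i * v j

/-- The polynomials computed at the vertices of a circuit. -/
noncomputable def Circuit.val : {n : ℕ} → Circuit n → Fin n → Poly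
  | _, .nil => Fin.elim0
  | _, .snoc C g => Fin.snoc (α := fun _ => Poly) C.val (g.eval C.val)

/-- Polynomials of circuit size (number of vertices) at most `s`. -/
def circuitSizeLE (s : ℕ) : Set Poly :=
  {p | ∃ n : ℕ, n ≤ s ∧ ∃ C : Circuit n, ∃ i : Fin n, C.val i = p}

/-! ### Permanents -/

/-- Polynomials of permanental complexity at most `s`: permanents of matrices of size at most `s`
with affine linear entries. -/
def permanentSizeLE (s : ℕ) : Set Poly :=
  {p | ∃ n : ℕ, n ≤ s ∧ ∃ M : Matrix (Fin n) (Fin n) Poly,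
    (∀ i j, (M i j).totalDegree ≤ 1) ∧ p = M.permanent}

/-- The permanent of the generic `n × n` matrix. -/
noncomputable def per (n : ℕ) : Poly :=
  (Matrix.of fun i j : Fin n => (X (Nat.pair i j) : Poly)).permanent

/-! ### Limits and complexity classes -/

/-- The set of limits of elements of `S`, with respect to the Euclidean topology on the
(finite-dimensional) coefficient spaces: all members of the sequence have their monomials in one
common finite set, and every coefficient converges. -/
def limits (S : Set Poly) : Set Poly :=
  {p | ∃ u : ℕ → Poly, (∀ k, u k ∈ S) ∧
    (∃ M : Finset (ℕ →₀ ℕ), ∀ k, (u k).support ⊆ M) ∧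
    ∀ e : ℕ →₀ ℕ, Tendsto (fun k => coeff e (u k)) atTop (𝓝 (coeff e p))}

/-- The p-families whose complexity is bounded by a sequence in `B`, where `K s` is the set of
polynomials of complexity at most `s`. -/
def complexityClass (B : Set (ℕ → ℕ)) (K : ℕ → Set Poly) : Set (ℕ → Poly) :=
  {f | f ∈ PFamilies ∧ ∃ s ∈ B, ∀ n, f n ∈ K (s n)}

/-- p-families of polynomially bounded formula size. -/
def VF : Set (ℕ → Poly) := complexityClass PolyBounded formulaSizeLE

/-- p-families of polynomially bounded border formula size. -/
def VFBar : Set (ℕ → Poly) := complexityClass PolyBounded fun s => limits (formulaSizeLE s)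

/-- p-families of quasipolynomially bounded circuit size. -/
def VQP : Set (ℕ → Poly) := complexityClass QuasiPolyBounded circuitSizeLE

/-- p-families of quasipolynomially bounded border circuit size. -/
def VQPBar : Set (ℕ → Poly) := complexityClass QuasiPolyBounded fun s => limits (circuitSizeLE s)

/-- p-families of polynomially bounded permanental complexity. -/
def VNP : Set (ℕ → Poly) := complexityClass PolyBounded permanentSizeLE

/-! ### Homogeneous linear projections -/

/-- The polynomials `q ∘ A`, `A` linear, that is, the polynomials that arise from `q` by replacing
the variables by homogeneous linear polynomials. -/
def linearSubstitutions (q : Poly) : Set Poly :=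
  {p | ∃ l : ℕ → Poly, (∀ i, (l i).IsHomogeneous 1) ∧ p = bind₁ l q}

/-- `p ≤_homlin q` for `p`, `q` homogeneous of degree `d` (or zero). In degree `0` every `p` is by
convention a projection of every nonzero `q`. -/
def HomLin (d : ℕ) (p q : Poly) : Prop :=
  (d = 0 ∧ q ≠ 0) ∨ p ∈ linearSubstitutions q

/-- `p ⊴_homlin q` for `p`, `q` homogeneous of degree `d` (or zero), with the same convention in
degree `0`. -/
def BorderHomLin (d : ℕ) (p q : Poly) : Prop :=
  (d = 0 ∧ q ≠ 0) ∨ p ∈ limits (linearSubstitutions q)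

/-- The reduction `∃ m ∈ B, ∀ n d, f n d ≤ h (m n) d` between graded families. -/
def Reduces (B : Set (ℕ → ℕ)) (R : ℕ → Poly → Poly → Prop) (f h : ℕ → ℕ → Poly) : Prop :=
  ∃ m ∈ B, ∀ n d, R d (f n d) (h (m n) d)

/-- `f ≤_{p-homlin} h` -/
def PHomLin : (f h : ℕ → ℕ → Poly) → Prop := Reduces PolyBounded HomLin

/-- `f ⊴_{p-homlin} h` -/
def BorderPHomLin : (f h : ℕ → ℕ → Poly) → Prop := Reduces PolyBounded BorderHomLin

/-- `f ≤_{qp-homlin} h` -/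
def QPHomLin : (f h : ℕ → ℕ → Poly) → Prop := Reduces QuasiPolyBounded HomLin

/-- `f ⊴_{qp-homlin} h` -/
def BorderQPHomLin : (f h : ℕ → ℕ → Poly) → Prop := Reduces QuasiPolyBounded BorderHomLin

/-- An ungraded family as a graded one: the entry `(n, d)` is the homogeneous component of
degree `d` of `g n`. -/
noncomputable def graded (g : ℕ → Poly) (n d : ℕ) : Poly := homogeneousComponent d (g n)

/-! ### The noncommutative elementary symmetric polynomials -/

open Classical in
/-- `∑_{I₁ < ⋯ < I_d} A_{I₁} ⋯ A_{I_d}`, the product being taken in this order. -/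
noncomputable def ncElem {R : Type*} [Semiring R] {n : ℕ} (d : ℕ) (A : Fin n → R) : R :=
  ∑ I : Fin d → Fin n with StrictMono I, (List.ofFn fun j => A (I j)).prod

/-- The `i`-th `3 × 3` matrix of fresh variables. -/
noncomputable def freshMatrix (i : ℕ) : Matrix (Fin 3) (Fin 3) Poly :=
  Matrix.of fun a b => X (9 * i + 3 * (a : ℕ) + (b : ℕ))

/-- The sum of all nine entries of the degree `d` noncommutative elementary symmetric polynomial
in `n` generic `3 × 3` matrices. -/
noncomputable def nce3 (n d : ℕ) : Poly :=
  ∑ a : Fin 3, ∑ b : Fin 3, ncElem d (fun i : Fin n => freshMatrix i) a b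

end AlgComplexity

namespace AlgComplexity

open MvPolynomial Filter Topology

/-! ### Closure properties of the growth bounds -/

/-! Every permanent of an affine linear matrix is an affine substitution of some `per r`, so each
inclusion of `VNP` in a class concerns the permanent alone. Two bounds then show that projections of
`nce3` capture formula size up to polynomial factors.

Upper bound: by the commutator trick of Ben-Or and Cleve (`transvection_commutator`), `1 + f E₀₁` is
a product of 3 × 3 transvections with affine linear entries; after balancing the formula of `f`,
their number is polynomial in its size (`Formula.hasLinearProducts`). Conjugation moves the constant
parts to the right end, leaving `∏ (1 + Aᵢ) · B` with `Aᵢ` homogeneous linear and `B` constant. The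
degree `d` part of `∏ (1 + Aᵢ)` is the elementary symmetric polynomial in the `Aᵢ`. Comparison in
degree `0` determines `B`, and for `d ≥ 1` the degree `d` part turns out to be `f_d E₀₁`, whose
entries sum to `f_d` (`IsLinearProduct.exists_elemList`).

Lower bound: `nce3` has polynomial formula size. Interpolation in `t` extracts it from the products
`∏ (1 + t Aᵢ)`, which are computed by repeated halving (`bind₁_nce3_mem_leavesLE`).

For circuits, the degree `d` component of a polynomial of circuit size `s` has a formula of size `(s
d) ^ O(log s · log d)`: the components of degree up to `2D` solve a triangular linear system over
those of degree up to `D` (`homogeneousComponent_mem_leavesLE_of_circuit`). Border versions follow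
because taking components and substituting are linear maps, hence compatible with limits
(`map_mem_limits`). The equality in the first item also needs `VF ⊆ VNP`, which comes from writing
formulas as permanents. -/

theorem exists_eval_le_pow (q : Polynomial ℝ) : ∃ N : ℕ, ∀ x : ℝ, 2 ≤ x → q.eval x ≤ x ^ N := by
  induction q using Polynomial.induction_on' with
  | add p q hp hq =>
    obtain ⟨a, ha⟩ := hp
    obtain ⟨b, hb⟩ := hq
    refine ⟨max a b + 1, fun x hx => ?_⟩
    have h1 : x ^ a ≤ x ^ max a b := pow_le_pow_right₀ (by linarith) (le_max_left _ _)
    have h2 : x ^ b ≤ x ^ max a b := pow_le_pow_right₀ (by linarith) (le_max_right _ _)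
    have h3 : 0 ≤ x ^ max a b := by positivity
    rw [Polynomial.eval_add, pow_succ]
    nlinarith [ha x hx, hb x hx]
  | monomial n a =>
    obtain ⟨k, hk⟩ := pow_unbounded_of_one_lt a (one_lt_two : (1 : ℝ) < 2)
    refine ⟨k + n, fun x hx => ?_⟩
    rw [Polynomial.eval_monomial, pow_add]
    have : (2 : ℝ) ^ k ≤ x ^ k := pow_le_pow_left₀ (by norm_num) hx k
    have h3 : 0 ≤ x ^ n := by positivity
    nlinarith

theorem exists_nat_eval_le_pow (q : Polynomial ℕ) : ∃ N : ℕ, ∀ x : ℕ, 2 ≤ x → q.eval x ≤ x ^ N := by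
  obtain ⟨N, hN⟩ := exists_eval_le_pow (q.map (Nat.castRingHom ℝ))
  refine ⟨N, fun x hx => ?_⟩
  have h := hN x (by exact_mod_cast hx)
  rw [Polynomial.eval_natCast_map] at h
  simp only [eq_natCast] at h
  exact_mod_cast h

theorem exists_eval_le_add_two_pow (q : Polynomial ℝ) :
    ∃ N : ℕ, ∀ x : ℝ, 0 ≤ x → q.eval x ≤ (x + 2) ^ N := by
  obtain ⟨N, hN⟩ := exists_eval_le_pow (q.comp (Polynomial.X - Polynomial.C 2))
  refine ⟨N, fun x hx => ?_⟩
  have h := hN (x + 2) (by linarith)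
  simpa [Polynomial.eval_comp] using h

theorem PolyBounded.exists_le_pow {c : ℕ → ℕ} (hc : c ∈ PolyBounded) :
    ∃ k : ℕ, ∀ n, c n ≤ (n + 2) ^ k := by
  obtain ⟨t, ht⟩ := hc
  obtain ⟨k, hk⟩ := exists_eval_le_add_two_pow t
  refine ⟨k, fun n => ?_⟩
  have h := (ht n).trans (hk n n.cast_nonneg)
  exact_mod_cast h

theorem PolyBounded.of_le_eval {c : ℕ → ℕ} (q : Polynomial ℕ) (h : ∀ n, c n ≤ q.eval n) :
    c ∈ PolyBounded := by
  refine ⟨q.map (Nat.castRingHom ℝ), fun n => ?_⟩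
  rw [Polynomial.eval_natCast_map]
  simp only [eq_natCast]
  exact_mod_cast h n

theorem PolyBounded.mul_add_one_pow {c : ℕ → ℕ} (hc : c ∈ PolyBounded) (a k : ℕ) :
    (fun n => a * (c n + 1) ^ k) ∈ PolyBounded := by
  obtain ⟨j, hj⟩ := PolyBounded.exists_le_pow hc
  refine PolyBounded.of_le_eval
    (Polynomial.C a * ((Polynomial.X + 2) ^ j + 1) ^ k) fun n => ?_
  simp only [Polynomial.eval_mul, Polynomial.eval_C, Polynomial.eval_pow, Polynomial.eval_add,
    Polynomial.eval_X, Polynomial.eval_one, Polynomial.eval_ofNat]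
  exact Nat.mul_le_mul_left _ (Nat.pow_le_pow_left (Nat.succ_le_succ (hj n)) _)

theorem PolyBounded.exists_comp_le {s m : ℕ → ℕ} (hs : s ∈ PolyBounded) (hm : m ∈ PolyBounded) :
    ∃ M ∈ PolyBounded, ∀ n, ∀ r ≤ s n, m r ≤ M n := by
  obtain ⟨j, hj⟩ := PolyBounded.exists_le_pow hm
  obtain ⟨k, hk⟩ := PolyBounded.exists_le_pow hs
  refine ⟨fun n => ((n + 2) ^ k + 2) ^ j, PolyBounded.of_le_eval
    (((Polynomial.X + 2) ^ k + 2) ^ j) fun n => by simp, fun n r hr => ?_⟩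
  refine (hj r).trans (Nat.pow_le_pow_left (Nat.add_le_add_right (hr.trans (hk n)) 2) j)

theorem logb_le_log_add_one {n : ℕ} (hn : n ≠ 0) : Real.logb 2 n ≤ (Nat.log 2 n + 1 : ℕ) := by
  rw [Real.logb_le_iff_le_rpow one_lt_two (by positivity), Real.rpow_natCast]
  exact_mod_cast (Nat.lt_pow_succ_log_self one_lt_two n).le

theorem log_le_logb {n : ℕ} (hn : n ≠ 0) : (Nat.log 2 n : ℝ) ≤ Real.logb 2 n := by
  rw [Real.le_logb_iff_rpow_le one_lt_two (by positivity), Real.rpow_natCast]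
  exact_mod_cast Nat.pow_log_le_self 2 hn

theorem natCast_rpow_eq {n : ℕ} (hn : n ≠ 0) (y : ℝ) :
    (n : ℝ) ^ y = 2 ^ (Real.logb 2 n * y) := by
  rw [Real.rpow_mul (by norm_num), Real.rpow_logb (by norm_num) (by norm_num) (by positivity)]

/-- Together with `of_le_two_pow_eval` this replaces real exponents by the form `2 ^ polylog n`, in
which products and powers become sums and products of exponents. The base `log n + 2` is at least
`2`, so a single power of it absorbs any polynomial. -/
theorem QuasiPolyBounded.exists_le_two_pow {c : ℕ → ℕ} (hc : c ∈ QuasiPolyBounded) :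
    ∃ k : ℕ, ∀ n, 2 ≤ n → c n ≤ 2 ^ (Nat.log 2 n + 2) ^ k := by
  obtain ⟨q, hq⟩ := hc
  obtain ⟨N, hN⟩ := exists_eval_le_add_two_pow q
  -- One extra factor `L` comes from `n = 2 ^ L`; the doubling pays for rounding the logarithm down,
  -- as `l + 3 ≤ (l + 2) ^ 2`.
  refine ⟨2 * (N + 1), fun n hn => ?_⟩
  have hn0 : n ≠ 0 := by omega
  have h := hq n hn
  rw [natCast_rpow_eq hn0] at h
  set L := Real.logb 2 n with hL
  have hL1 : 0 ≤ L := (Nat.cast_nonneg _).trans (log_le_logb hn0)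
  have hL2 : L ≤ (Nat.log 2 n + 1 : ℕ) := logb_le_log_add_one hn0
  have h2 : L * q.eval L ≤ (((Nat.log 2 n + 2) ^ (2 * (N + 1)) : ℕ) : ℝ) := by
    calc L * q.eval L ≤ (L + 2) * (L + 2) ^ N := by
          have := hN L hL1
          have h3 : 0 ≤ (L + 2) ^ N := by positivity
          nlinarith
      _ = (L + 2) ^ (N + 1) := by ring
      _ ≤ (((Nat.log 2 n + 2 : ℕ) : ℝ) ^ 2) ^ (N + 1) := by
          gcongr
          push_cast at hL2 ⊢
          nlinarith [(Nat.cast_nonneg (Nat.log 2 n) : (0 : ℝ) ≤ _)]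
      _ = _ := by rw [← pow_mul]; push_cast; rfl
  have h3 := h.trans (Real.rpow_le_rpow_of_exponent_le (by norm_num) h2)
  rw [Real.rpow_natCast] at h3
  exact_mod_cast h3

theorem QuasiPolyBounded.of_le_two_pow_eval {c : ℕ → ℕ} (q : Polynomial ℕ)
    (h : ∀ n, 2 ≤ n → c n ≤ 2 ^ q.eval (Nat.log 2 n + 2)) : c ∈ QuasiPolyBounded := by
  obtain ⟨N, hN⟩ := exists_nat_eval_le_pow q
  refine ⟨(Polynomial.X + Polynomial.C 2) ^ N, fun n hn => ?_⟩
  have hn0 : n ≠ 0 := by omega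
  have h1 : c n ≤ 2 ^ (Nat.log 2 n + 2) ^ N :=
    (h n hn).trans (Nat.pow_le_pow_right two_pos (hN _ (by omega)))
  have h2 : (c n : ℝ) ≤ 2 ^ (((Nat.log 2 n + 2) ^ N : ℕ) : ℝ) := by
    rw [Real.rpow_natCast]
    exact_mod_cast h1
  rw [natCast_rpow_eq hn0]
  refine h2.trans (Real.rpow_le_rpow_of_exponent_le (by norm_num) ?_)
  have hlog : 1 ≤ Nat.log 2 n := Nat.log_pos one_lt_two hn
  have hl := log_le_logb hn0
  have hL1 : 1 ≤ Real.logb 2 n := le_trans (by exact_mod_cast hlog) hl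
  simp only [Polynomial.eval_pow, Polynomial.eval_add, Polynomial.eval_X, Polynomial.eval_C]
  calc (((Nat.log 2 n + 2) ^ N : ℕ) : ℝ) ≤ (Real.logb 2 n + 2) ^ N := by
        push_cast
        gcongr
    _ ≤ _ := le_mul_of_one_le_left (by positivity) hL1

theorem QuasiPolyBounded.mul_add_one_pow {c : ℕ → ℕ} (hc : c ∈ QuasiPolyBounded) (a k : ℕ) :
    (fun n => a * (c n + 1) ^ k) ∈ QuasiPolyBounded := by
  obtain ⟨j, hj⟩ := QuasiPolyBounded.exists_le_two_pow hc
  refine QuasiPolyBounded.of_le_two_pow_eval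
    (Polynomial.C a + (Polynomial.X ^ j + 1) * Polynomial.C k) fun n hn => ?_
  simp only [Polynomial.eval_mul, Polynomial.eval_C, Polynomial.eval_pow, Polynomial.eval_add,
    Polynomial.eval_X, Polynomial.eval_one]
  rw [pow_add, pow_mul]
  gcongr
  · exact Nat.lt_two_pow_self.le
  · rw [pow_succ]
    have := hj n hn
    have := Nat.one_le_two_pow (n := (Nat.log 2 n + 2) ^ j)
    omega

theorem QuasiPolyBounded.exists_comp_le {s m : ℕ → ℕ} (hs : s ∈ PolyBounded)
    (hm : m ∈ QuasiPolyBounded) :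
    ∃ M ∈ QuasiPolyBounded, ∀ n, ∀ r ≤ s n, m r ≤ M n := by
  obtain ⟨j, hj⟩ := QuasiPolyBounded.exists_le_two_pow hm
  obtain ⟨k, hk⟩ := PolyBounded.exists_le_pow hs
  -- `m` need not be monotone, so a running maximum is used. The values `m 0` and `m 1` are not
  -- controlled by the quasipolynomial bound and enter as a constant.
  refine ⟨fun n => (Finset.range (s n + 1)).sup m, QuasiPolyBounded.of_le_two_pow_eval
    (Polynomial.C (m 0 + m 1) + (Polynomial.X * Polynomial.C k + 2) ^ j) fun n hn => ?_,
    fun n r hr => Finset.le_sup (f := m) (Finset.mem_range.2 (Nat.lt_succ_of_le hr))⟩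
  simp only [Polynomial.eval_mul, Polynomial.eval_C, Polynomial.eval_pow, Polynomial.eval_add,
    Polynomial.eval_X, Polynomial.eval_ofNat]
  refine Finset.sup_le fun r hr => ?_
  have hr : r ≤ s n := Nat.lt_succ_iff.1 (Finset.mem_range.1 hr)
  rcases Nat.lt_or_ge r 2 with h2 | h2
  · refine le_trans ?_ (Nat.pow_le_pow_right two_pos (Nat.le_add_right _ _))
    refine le_trans ?_ Nat.lt_two_pow_self.le
    interval_cases r <;> omega
  · refine (hj r h2).trans (Nat.pow_le_pow_right two_pos (le_trans ?_ (Nat.le_add_left _ _)))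
    gcongr
    have h3 : n + 2 ≤ 2 ^ (Nat.log 2 n + 2) := by
      have := Nat.lt_pow_succ_log_self one_lt_two n
      have h4 : 2 ^ (Nat.log 2 n + 2) = 2 * 2 ^ (Nat.log 2 n).succ := by
        rw [Nat.succ_eq_add_one]; ring
      omega
    calc Nat.log 2 r ≤ Nat.log 2 ((2 ^ (Nat.log 2 n + 2)) ^ k) :=
          Nat.log_mono_right ((hr.trans (hk n)).trans (Nat.pow_le_pow_left h3 k))
      _ = _ := by rw [← pow_mul, Nat.log_pow one_lt_two]

/-! ### Formulas measured by their number of leaves -/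

/-- The number of leaves of a formula. -/
def Formula.leaves : Formula → ℕ
  | .leaf _ _ => 1
  | .add F G => F.leaves + G.leaves
  | .mul F G => F.leaves + G.leaves

theorem Formula.leaves_pos (F : Formula) : 0 < F.leaves := by
  induction F <;> simp only [Formula.leaves] <;> omega

theorem Formula.size_add_one (F : Formula) : F.size + 1 = 2 * F.leaves := by
  induction F <;> simp only [Formula.leaves, Formula.size] <;> omega

/-- The formula consisting of a single constant. -/
noncomputable def Formula.const (c : ℂ) : Formula := .leaf (C c) (by simp)

/-- Polynomials computed by a formula with at most `ℓ` leaves. -/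
def leavesLE (ℓ : ℕ) : Set Poly :=
  {p | ∃ F : Formula, F.leaves ≤ ℓ ∧ F.eval = p}

theorem leavesLE_subset_formulaSizeLE (ℓ : ℕ) : leavesLE ℓ ⊆ formulaSizeLE (2 * ℓ) := by
  rintro p ⟨F, hF, rfl⟩
  exact ⟨F, by have := F.size_add_one; omega, rfl⟩

theorem leavesLE_mono {a b : ℕ} (h : a ≤ b) : leavesLE a ⊆ leavesLE b :=
  fun _ ⟨F, hF, e⟩ => ⟨F, hF.trans h, e⟩

theorem leaf_mem_leavesLE {l : Poly} (hl : l.totalDegree ≤ 1) {a : ℕ} (ha : 1 ≤ a) :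
    l ∈ leavesLE a := ⟨.leaf l hl, ha, rfl⟩

theorem C_mem_leavesLE (c : ℂ) {a : ℕ} (ha : 1 ≤ a) : (C c : Poly) ∈ leavesLE a :=
  leaf_mem_leavesLE (by simp) ha

theorem zero_mem_leavesLE {a : ℕ} (ha : 1 ≤ a) : (0 : Poly) ∈ leavesLE a := by
  simpa using C_mem_leavesLE 0 ha

theorem one_mem_leavesLE {a : ℕ} (ha : 1 ≤ a) : (1 : Poly) ∈ leavesLE a := by
  simpa using C_mem_leavesLE 1 ha

theorem add_mem_leavesLE {p q : Poly} {a b : ℕ} (hp : p ∈ leavesLE a) (hq : q ∈ leavesLE b) :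
    p + q ∈ leavesLE (a + b) := by
  obtain ⟨F, hF, rfl⟩ := hp
  obtain ⟨G, hG, rfl⟩ := hq
  exact ⟨.add F G, add_le_add hF hG, rfl⟩

theorem mul_mem_leavesLE {p q : Poly} {a b : ℕ} (hp : p ∈ leavesLE a) (hq : q ∈ leavesLE b) :
    p * q ∈ leavesLE (a + b) := by
  obtain ⟨F, hF, rfl⟩ := hp
  obtain ⟨G, hG, rfl⟩ := hq
  exact ⟨.mul F G, add_le_add hF hG, rfl⟩

theorem sum_mem_leavesLE {ι : Type*} (s : Finset ι) (p : ι → Poly) {a N : ℕ}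
    (hp : ∀ i ∈ s, p i ∈ leavesLE a) (hs : s.card ≤ N) (hN : 1 ≤ N) (ha : 1 ≤ a) :
    ∑ i ∈ s, p i ∈ leavesLE (N * a) := by
  classical
  rcases s.eq_empty_or_nonempty with rfl | hne
  · simpa using zero_mem_leavesLE (Nat.mul_pos hN ha)
  · refine leavesLE_mono (Nat.mul_le_mul_right a hs) ?_
    induction hne using Finset.Nonempty.cons_induction with
    | singleton i => simpa using hp i
    | cons i s hi hne ih =>
      rw [Finset.sum_cons, Finset.card_cons, add_mul, one_mul]
      rw [add_comm (p i)]
      refine add_mem_leavesLE (ih (fun j hj => hp j (Finset.mem_cons_of_mem hj)) ?_)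
        (hp i (Finset.mem_cons_self i s))
      exact (Nat.le_succ _).trans (by rwa [Finset.card_cons] at hs)

/-! ### Balancing formulas -/

/-- A formula with more than `t` leaves is an affine linear function of the value of a subformula
with between `t / 2` and `t` leaves. -/
theorem Formula.exists_subformula (t : ℕ) (ht : 1 ≤ t) (F : Formula) (hF : t < F.leaves) :
    ∃ G H₀ H₁ : Formula, G.leaves ≤ t ∧ t < 2 * G.leaves ∧
      H₀.leaves + G.leaves = F.leaves + 1 ∧ H₁.leaves + G.leaves = F.leaves + 1 ∧
      F.eval = H₀.eval + G.eval * (H₁.eval - H₀.eval) := by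
  induction F with
  | leaf l hl => simp only [Formula.leaves] at hF; omega
  | add A B hA hB =>
    simp only [Formula.leaves] at hF
    simp only [Formula.leaves, Formula.eval]
    -- Descend into the child with more leaves until at most `t` remain; the parent has more than
    -- `t`, so this child has more than `t / 2`. `H₀` and `H₁` are `F` with the chosen subformula
    -- replaced by `0` and `1`.
    rcases le_total B.leaves A.leaves with h | h
    · rcases Nat.lt_or_ge t A.leaves with h' | h'
      · obtain ⟨G, H₀, H₁, h1, h2, h3, h4, h5⟩ := hA h'
        refine ⟨G, .add H₀ B, .add H₁ B, h1, h2, ?_, ?_, ?_⟩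
        · simp only [Formula.leaves]; omega
        · simp only [Formula.leaves]; omega
        · simp only [Formula.eval, h5]; ring
      · refine ⟨A, .add (.const 0) B, .add (.const 1) B, h', by omega, ?_, ?_, ?_⟩
        · simp only [Formula.leaves, Formula.const]; omega
        · simp only [Formula.leaves, Formula.const]; omega
        · simp only [Formula.eval, Formula.const, C_0, C_1]; ring
    · rcases Nat.lt_or_ge t B.leaves with h' | h'
      · obtain ⟨G, H₀, H₁, h1, h2, h3, h4, h5⟩ := hB h'
        refine ⟨G, .add A H₀, .add A H₁, h1, h2, ?_, ?_, ?_⟩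
        · simp only [Formula.leaves]; omega
        · simp only [Formula.leaves]; omega
        · simp only [Formula.eval, h5]; ring
      · refine ⟨B, .add A (.const 0), .add A (.const 1), h', by omega, ?_, ?_, ?_⟩
        · simp only [Formula.leaves, Formula.const]; omega
        · simp only [Formula.leaves, Formula.const]; omega
        · simp only [Formula.eval, Formula.const, C_0, C_1]; ring
  | mul A B hA hB =>
    simp only [Formula.leaves] at hF
    simp only [Formula.leaves, Formula.eval]
    rcases le_total B.leaves A.leaves with h | h
    · rcases Nat.lt_or_ge t A.leaves with h' | h'
      · obtain ⟨G, H₀, H₁, h1, h2, h3, h4, h5⟩ := hA h'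
        refine ⟨G, .mul H₀ B, .mul H₁ B, h1, h2, ?_, ?_, ?_⟩
        · simp only [Formula.leaves]; omega
        · simp only [Formula.leaves]; omega
        · simp only [Formula.eval, h5]; ring
      · refine ⟨A, .mul (.const 0) B, .mul (.const 1) B, h', by omega, ?_, ?_, ?_⟩
        · simp only [Formula.leaves, Formula.const]; omega
        · simp only [Formula.leaves, Formula.const]; omega
        · simp only [Formula.eval, Formula.const, C_0, C_1]; ring
    · rcases Nat.lt_or_ge t B.leaves with h' | h'
      · obtain ⟨G, H₀, H₁, h1, h2, h3, h4, h5⟩ := hB h'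
        refine ⟨G, .mul A H₀, .mul A H₁, h1, h2, ?_, ?_, ?_⟩
        · simp only [Formula.leaves]; omega
        · simp only [Formula.leaves]; omega
        · simp only [Formula.eval, h5]; ring
      · refine ⟨B, .mul A (.const 0), .mul A (.const 1), h', by omega, ?_, ?_, ?_⟩
        · simp only [Formula.leaves, Formula.const]; omega
        · simp only [Formula.leaves, Formula.const]; omega
        · simp only [Formula.eval, Formula.const, C_0, C_1]; ring

/-! ### Products of `3 × 3` matrices -/

/-- `P` is, up to a constant invertible factor on the right, a product of `m` matrices of the form
`1 + A` where the entries of `A` are homogeneous linear polynomials. -/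
def IsLinearProduct (m : ℕ) (P : Matrix (Fin 3) (Fin 3) Poly) : Prop :=
  ∃ (L : List (Matrix (Fin 3) (Fin 3) Poly)) (B B' : Matrix (Fin 3) (Fin 3) ℂ),
    L.length = m ∧ (∀ A ∈ L, ∀ i j, (A i j).IsHomogeneous 1) ∧ B * B' = 1 ∧
    P = (L.map (1 + ·)).prod * B.map C

theorem matrix_map_C_mul (A B : Matrix (Fin 3) (Fin 3) ℂ) :
    (A * B).map (C : ℂ → Poly) = A.map C * B.map C :=
  Matrix.map_mul (f := (C : ℂ →+* Poly))

theorem matrix_map_C_one : (1 : Matrix (Fin 3) (Fin 3) ℂ).map (C : ℂ → Poly) = 1 :=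
  Matrix.map_one _ C_0 C_1

/-- From `B (1 + A) = (1 + B A B') B`: constant factors can be pushed to the right end, which makes
`IsLinearProduct` closed under multiplication. -/
theorem conj_list_prod (L : List (Matrix (Fin 3) (Fin 3) Poly))
    {B B' : Matrix (Fin 3) (Fin 3) Poly} (h : B' * B = 1) :
    B * (L.map (1 + ·)).prod = ((L.map fun A => B * A * B').map (1 + ·)).prod * B := by
  induction L with
  | nil => simp
  | cons A L ih =>
    simp only [List.map_cons, List.prod_cons]
    rw [mul_assoc _ _ B, ← ih]
    simp only [mul_add, add_mul, one_mul, mul_assoc]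
    rw [← mul_assoc B' B, h, one_mul]

theorem isHomogeneous_one_conj {A : Matrix (Fin 3) (Fin 3) Poly}
    (hA : ∀ i j, (A i j).IsHomogeneous 1) (B B' : Matrix (Fin 3) (Fin 3) ℂ) (i j : Fin 3) :
    ((B.map (C : ℂ → Poly) * A * B'.map (C : ℂ → Poly)) i j).IsHomogeneous 1 := by
  simp only [Matrix.mul_apply, Matrix.map_apply]
  refine IsHomogeneous.sum _ _ _ fun k _ => ?_
  rw [mul_comm]
  exact (IsHomogeneous.sum _ _ _ fun r _ => (hA r k).C_mul _).C_mul _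

theorem IsLinearProduct.mul {m n : ℕ} {P Q : Matrix (Fin 3) (Fin 3) Poly}
    (hP : IsLinearProduct m P) (hQ : IsLinearProduct n Q) : IsLinearProduct (m + n) (P * Q) := by
  obtain ⟨L, B, B', rfl, hL, hB, rfl⟩ := hP
  obtain ⟨M, D, D', rfl, hM, hD, rfl⟩ := hQ
  have hB2 : B'.map (C : ℂ → Poly) * B.map C = 1 := by
    rw [← matrix_map_C_mul, mul_eq_one_comm.1 hB, matrix_map_C_one]
  refine ⟨L ++ M.map fun A => B.map (C : ℂ → Poly) * A * B'.map (C : ℂ → Poly), B * D, D' * B',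
    by simp, ?_, ?_, ?_⟩
  · intro A hA
    rcases List.mem_append.1 hA with h | h
    · exact hL A h
    · obtain ⟨A', hA', rfl⟩ := List.mem_map.1 h
      exact isHomogeneous_one_conj (hM A' hA') B B'
  · rw [mul_assoc, ← mul_assoc D, hD, one_mul, hB]
  · rw [List.map_append, List.prod_append, matrix_map_C_mul, mul_assoc _ (B.map C),
      ← mul_assoc (B.map C), conj_list_prod M hB2]
    simp only [mul_assoc]

/-- Padding by zero matrices: the exact length `m` may be read as "at most `m`". -/
theorem IsLinearProduct.one (m : ℕ) : IsLinearProduct m 1 := by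
  refine ⟨List.replicate m 0, 1, 1, by simp, ?_, by simp, ?_⟩
  · intro A hA i j
    rw [List.eq_of_mem_replicate hA]
    exact isHomogeneous_zero _ _ _
  · simp [matrix_map_C_one]

theorem IsLinearProduct.mono {m n : ℕ} (h : m ≤ n) {P : Matrix (Fin 3) (Fin 3) Poly}
    (hP : IsLinearProduct m P) : IsLinearProduct n P := by
  simpa [Nat.add_sub_cancel' h] using hP.mul (IsLinearProduct.one (n - m))

theorem eq_homogeneousComponent_add_C {l : Poly} (hl : l.totalDegree ≤ 1) :
    l = homogeneousComponent 1 l + C (coeff 0 l) := by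
  rw [← homogeneousComponent_zero]
  nth_rewrite 1 [← sum_homogeneousComponent l]
  have h : l.totalDegree = 0 ∨ l.totalDegree = 1 := by omega
  rcases h with h | h
  · rw [h, Finset.sum_range_one, homogeneousComponent_eq_zero 1 l (by omega), zero_add]
  · rw [h, Finset.sum_range_succ, Finset.sum_range_one, add_comm]

theorem transvection_map_C (i j : Fin 3) (c : ℂ) :
    (Matrix.transvection i j c).map (C : ℂ → Poly) = Matrix.transvection i j (C c) := by
  ext a b
  simp only [Matrix.transvection, Matrix.map_apply, Matrix.add_apply, Matrix.one_apply,
    Matrix.single_apply, C_add]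
  split_ifs <;> simp

/-- Transvections at the same position multiply by adding their entries, so the linear part of `l`
gives the one factor `1 + A` and its constant term gives `B`. -/
theorem IsLinearProduct.transvection {i j : Fin 3} (hij : i ≠ j) {l : Poly}
    (hl : l.totalDegree ≤ 1) : IsLinearProduct 1 (Matrix.transvection i j l) := by
  refine ⟨[Matrix.single i j (homogeneousComponent 1 l)], Matrix.transvection i j (coeff 0 l),
    Matrix.transvection i j (-coeff 0 l), rfl, ?_, ?_, ?_⟩
  · intro A hA a b
    rw [List.mem_singleton.1 hA, Matrix.single_apply]
    split_ifs
    · exact homogeneousComponent_isHomogeneous _ _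
    · exact isHomogeneous_zero _ _ _
  · rw [Matrix.transvection_mul_transvection_same _ _ hij, add_neg_cancel,
      Matrix.transvection_zero]
  · rw [transvection_map_C]
    simp only [List.map_cons, List.map_nil, List.prod_singleton]
    rw [← Matrix.transvection.eq_1, Matrix.transvection_mul_transvection_same _ _ hij,
      ← eq_homogeneousComponent_add_C hl]

/-- All elementary matrices with off-diagonal entry `f` or `-f` are products of `m` factors. -/
def HasLinearProducts (m : ℕ) (f : Poly) : Prop :=
  ∀ i j : Fin 3, i ≠ j → IsLinearProduct m (Matrix.transvection i j f) ∧
    IsLinearProduct m (Matrix.transvection i j (-f))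

theorem HasLinearProducts.mono {m n : ℕ} (h : m ≤ n) {f : Poly} (hf : HasLinearProducts m f) :
    HasLinearProducts n f := fun i j hij => ⟨(hf i j hij).1.mono h, (hf i j hij).2.mono h⟩

theorem HasLinearProducts.neg {m : ℕ} {f : Poly} (hf : HasLinearProducts m f) :
    HasLinearProducts m (-f) := fun i j hij => by
  rw [neg_neg]
  exact (hf i j hij).symm

theorem HasLinearProducts.leaf {l : Poly} (hl : l.totalDegree ≤ 1) : HasLinearProducts 1 l :=
  fun _ _ hij => ⟨.transvection hij hl, .transvection hij (by rwa [totalDegree_neg])⟩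

theorem HasLinearProducts.add {m n : ℕ} {f g : Poly} (hf : HasLinearProducts m f)
    (hg : HasLinearProducts n g) : HasLinearProducts (m + n) (f + g) := fun i j hij => by
  rw [neg_add, ← Matrix.transvection_mul_transvection_same _ _ hij,
    ← Matrix.transvection_mul_transvection_same _ _ hij]
  exact ⟨(hf i j hij).1.mul (hg i j hij).1, (hf i j hij).2.mul (hg i j hij).2⟩

/-- Multiplication as a commutator: the only surviving mixed term is `E_ik E_kj = E_ij`. A third
index `k` is needed, hence size 3. The inverses are the reason for keeping track of both `f` and
`-f`. -/
theorem transvection_commutator {i j k : Fin 3} (hij : i ≠ j) (hik : i ≠ k) (hkj : k ≠ j)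
    (f g : Poly) :
    Matrix.transvection i k f * Matrix.transvection k j g * Matrix.transvection i k (-f) *
      Matrix.transvection k j (-g) = Matrix.transvection i j (f * g) := by
  have hneg : ∀ (a b : Fin 3) (p : Poly), Matrix.single a b (-p) = -Matrix.single a b p :=
    fun a b p => map_neg (Matrix.singleAddMonoidHom a b) p
  simp only [Matrix.transvection, mul_add, add_mul, one_mul, mul_one,
    Matrix.single_mul_single_same, Matrix.single_mul_single_of_ne _ _ _ _ hij.symm,
    Matrix.single_mul_single_of_ne _ _ _ _ hik.symm,
    Matrix.single_mul_single_of_ne _ _ _ _ hkj.symm, zero_mul, mul_neg, neg_mul,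
    hneg]
  abel

theorem HasLinearProducts.mul {m n : ℕ} {f g : Poly} (hf : HasLinearProducts m f)
    (hg : HasLinearProducts n g) : HasLinearProducts (2 * (m + n)) (f * g) := fun i j hij => by
  obtain ⟨k, hik, hkj⟩ : ∃ k : Fin 3, i ≠ k ∧ k ≠ j := by decide +revert
  have h : 2 * (m + n) = m + n + m + n := by ring
  rw [← neg_mul, ← transvection_commutator hij hik hkj, ← transvection_commutator hij hik hkj,
    neg_neg, h]
  have hf' := hf i k hik
  have hg' := hg k j hkj
  exact ⟨((hf'.1.mul hg'.1).mul hf'.2).mul hg'.2, ((hf'.2.mul hg'.1).mul hf'.1).mul hg'.2⟩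

theorem Formula.hasLinearProducts_four_pow (F : Formula) :
    HasLinearProducts (4 ^ F.leaves) F.eval := by
  induction F with
  | leaf l hl => exact (HasLinearProducts.leaf hl).mono (Nat.one_le_pow _ _ (by norm_num))
  | add A B hA hB =>
    have ha : 4 ^ 1 ≤ 4 ^ A.leaves := Nat.pow_le_pow_right (by norm_num) A.leaves_pos
    have hb : 4 ^ 1 ≤ 4 ^ B.leaves := Nat.pow_le_pow_right (by norm_num) B.leaves_pos
    refine (hA.add hB).mono ?_
    rw [Formula.leaves, pow_add]
    nlinarith
  | mul A B hA hB =>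
    have ha : 4 ^ 1 ≤ 4 ^ A.leaves := Nat.pow_le_pow_right (by norm_num) A.leaves_pos
    have hb : 4 ^ 1 ≤ 4 ^ B.leaves := Nat.pow_le_pow_right (by norm_num) B.leaves_pos
    refine (hA.mul hB).mono ?_
    rw [Formula.leaves, pow_add]
    nlinarith

/-- Each multiplication doubles the length, so the direct translation is exponential in depth.
Cutting the formula at a subformula of intermediate size makes the length polynomial. -/
theorem Formula.hasLinearProducts (F : Formula) :
    HasLinearProducts (256 * F.leaves ^ 11) F.eval := by
  induction h : F.leaves using Nat.strong_induction_on generalizing F with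
  | _ ℓ ih =>
    subst h
    rcases Nat.lt_or_ge F.leaves 5 with h5 | h5
    · refine F.hasLinearProducts_four_pow.mono ?_
      calc 4 ^ F.leaves ≤ 4 ^ 4 := Nat.pow_le_pow_right (by norm_num) (by omega)
        _ ≤ 256 * F.leaves ^ 11 := Nat.le_mul_of_pos_right _ (pow_pos F.leaves_pos 11)
    -- With at least 5 leaves, all three pieces have at most `5/6` of the leaves.
    · obtain ⟨G, H₀, H₁, h1, h2, h3, h4, h5⟩ :=
        F.exists_subformula (2 * F.leaves / 3) (by omega) (by omega)
      have hG := ih _ (by omega) G rfl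
      have hH₀ := ih _ (by omega) H₀ rfl
      have hH₁ := ih _ (by omega) H₁ rfl
      -- The length of `H₀ + G (H₁ - H₀)` is a sum of 7 lengths of pieces (`3` for `H₀`, `2` each
      -- for `G` and `H₁`), and `11` is the least exponent `k` with `(6/5) ^ k ≥ 7`.
      have key : ∀ a : ℕ, 6 * a ≤ 5 * F.leaves → 7 * a ^ 11 ≤ F.leaves ^ 11 := fun a ha => by
        have := Nat.pow_le_pow_left ha 11
        rw [mul_pow, mul_pow] at this
        norm_num at this
        omega
      rw [h5, sub_eq_add_neg]
      refine (hH₀.add (hG.mul (hH₁.add hH₀.neg))).mono ?_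
      have k1 := key G.leaves (by omega)
      have k2 := key H₀.leaves (by omega)
      have k3 := key H₁.leaves (by omega)
      omega

/-! ### Recursion for the noncommutative elementary symmetric polynomials -/

/-- The noncommutative elementary symmetric polynomial of degree `d` in the entries of a list. -/
def elemList {R : Type*} [Semiring R] : ℕ → List R → R
  | 0, _ => 1
  | _ + 1, [] => 0
  | d + 1, a :: L => a * elemList d L + elemList (d + 1) L

theorem strictMono_cons_zero_succ {n d : ℕ} {J : Fin d → Fin n} :
    StrictMono (Fin.cons 0 (Fin.succ ∘ J) : Fin (d + 1) → Fin (n + 1)) ↔ StrictMono J := by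
  constructor
  · intro h i j hij
    have := h (Fin.succ_lt_succ_iff.2 hij)
    simpa using this
  · intro h i j hij
    induction i using Fin.cases with
    | zero =>
      induction j using Fin.cases with
      | zero => exact absurd hij (lt_irrefl _)
      | succ j => simp
    | succ i =>
      induction j using Fin.cases with
      | zero => exact absurd hij (Fin.not_lt_zero _)
      | succ j => simpa using h (Fin.succ_lt_succ_iff.1 hij)

theorem ncElem_zero {R : Type*} [Semiring R] {n : ℕ} (A : Fin n → R) : ncElem 0 A = 1 := by
  have h : ∀ I : Fin 0 → Fin n, StrictMono I := fun I i => i.elim0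
  simp [ncElem, h]

-- Split the increasing tuples according to whether they start with `0`.
open Classical in
theorem ncElem_succ {R : Type*} [Semiring R] {n : ℕ} (d : ℕ) (A : Fin (n + 1) → R) :
    ncElem (d + 1) A =
      A 0 * ncElem d (fun i => A i.succ) + ncElem (d + 1) (fun i => A i.succ) := by
  unfold ncElem
  rw [← Finset.sum_filter_add_sum_filter_not _ (fun I : Fin (d + 1) → Fin (n + 1) => I 0 = 0)]
  congr 1
  · rw [Finset.mul_sum]
    symm
    refine Finset.sum_bij
      (fun J _ => (Fin.cons 0 (Fin.succ ∘ J) : Fin (d + 1) → Fin (n + 1))) ?_ ?_ ?_ ?_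
    · intro J hJ
      simp only [Finset.mem_filter, Finset.mem_univ, true_and] at hJ ⊢
      exact ⟨strictMono_cons_zero_succ.2 hJ, Fin.cons_zero _ _⟩
    · intro J _ J' _ h
      funext j
      simpa using congrFun h j.succ
    · intro I hI
      simp only [Finset.mem_filter, Finset.mem_univ, true_and] at hI
      have h : ∀ j : Fin d, ∃ k, Fin.succ k = I j.succ := fun j => by
        rw [Fin.exists_succ_eq]
        have := hI.1 (Fin.succ_pos j)
        exact (Fin.pos_iff_ne_zero.1 ((Fin.zero_le _).trans_lt this))
      choose J hJ using h
      have hc : (Fin.cons 0 (Fin.succ ∘ J) : Fin (d + 1) → Fin (n + 1)) = I := by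
        funext j
        induction j using Fin.cases with
        | zero => simp [hI.2]
        | succ j => simp [hJ]
      refine ⟨J, ?_, hc⟩
      simp only [Finset.mem_filter, Finset.mem_univ, true_and]
      rw [← strictMono_cons_zero_succ, hc]
      exact hI.1
    · intro J _
      simp [List.ofFn_succ]
  · symm
    refine Finset.sum_bij (fun J _ => (Fin.succ ∘ J : Fin (d + 1) → Fin (n + 1))) ?_ ?_ ?_ ?_
    · intro J hJ
      simp only [Finset.mem_filter, Finset.mem_univ, true_and] at hJ ⊢
      exact ⟨(Fin.strictMono_succ).comp hJ, Fin.succ_ne_zero _⟩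
    · intro J _ J' _ h
      funext j
      simpa using congrFun h j
    · intro I hI
      simp only [Finset.mem_filter, Finset.mem_univ, true_and] at hI
      have h : ∀ j, ∃ k, Fin.succ k = I j := fun j => by
        rw [Fin.exists_succ_eq]
        have := hI.1.monotone (Fin.zero_le j)
        exact Fin.pos_iff_ne_zero.1 ((Fin.pos_iff_ne_zero.2 hI.2).trans_le this)
      choose J hJ using h
      have hc : Fin.succ ∘ J = I := funext hJ
      refine ⟨J, ?_, hc⟩
      simp only [Finset.mem_filter, Finset.mem_univ, true_and]
      intro i j hij
      have := hI.1 hij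
      rw [← hJ i, ← hJ j] at this
      exact Fin.succ_lt_succ_iff.1 this
    · intro J _
      rfl

theorem ncElem_eq_elemList {R : Type*} [Semiring R] {n : ℕ} (d : ℕ) (A : Fin n → R) :
    ncElem d A = elemList d (List.ofFn A) := by
  induction n generalizing d with
  | zero =>
    cases d with
    | zero => rw [ncElem_zero, elemList]
    | succ d =>
      rw [List.ofFn_zero, elemList, ncElem]
      exact Finset.sum_eq_zero fun I _ => (I 0).elim0
  | succ n ih =>
    cases d with
    | zero => rw [ncElem_zero, elemList]
    | succ d => rw [ncElem_succ, ih, ih, List.ofFn_succ, elemList]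

theorem map_elemList {R S : Type*} [Semiring R] [Semiring S] (φ : R →+* S) (d : ℕ) (L : List R) :
    φ (elemList d L) = elemList d (L.map φ) := by
  induction L generalizing d with
  | nil => cases d <;> simp [elemList]
  | cons a L ih => cases d <;> simp [elemList, ih]

theorem bind₁_nce3 (l : ℕ → Poly) (m d : ℕ) :
    bind₁ l (nce3 m d) = ∑ a : Fin 3, ∑ b : Fin 3, elemList d (List.ofFn fun i : Fin m =>
      (Matrix.of fun a b : Fin 3 => l (9 * i + 3 * a + b) : Matrix (Fin 3) (Fin 3) Poly)) a b := by
  simp only [nce3, ncElem_eq_elemList, map_sum]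
  refine Finset.sum_congr rfl fun a _ => Finset.sum_congr rfl fun b _ => ?_
  have h := map_elemList (RingHom.mapMatrix (m := Fin 3)
    ((bind₁ l : Poly →ₐ[ℂ] Poly) : Poly →+* Poly)) d
    (List.ofFn fun i : Fin m => freshMatrix i)
  have h2 := congrFun (congrFun h a) b
  rw [List.map_ofFn] at h2
  refine Eq.trans ?_ (h2.trans ?_)
  · rfl
  · refine congrFun (congrFun (congrArg (fun f : Fin m → Matrix (Fin 3) (Fin 3) Poly =>
      elemList d (List.ofFn f)) ?_) a) b
    funext i
    ext1 a b
    simp [freshMatrix]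

/-! ### Homogeneous components of matrix products -/

theorem homogeneousComponent_mul_eq_sum (d : ℕ) (p q : Poly) :
    homogeneousComponent d (p * q) =
      ∑ x ∈ Finset.HasAntidiagonal.antidiagonal d,
        homogeneousComponent x.1 p * homogeneousComponent x.2 q := by
  ext e
  rw [coeff_homogeneousComponent, coeff_mul, coeff_sum]
  simp only [coeff_mul, coeff_homogeneousComponent]
  rw [Finset.sum_comm, ← Finset.sum_const_zero (s := Finset.HasAntidiagonal.antidiagonal e),
    ← Finset.sum_ite_irrel]
  · refine Finset.sum_congr rfl fun y hy => ?_
    rw [← Finset.HasAntidiagonal.mem_antidiagonal.1 hy, map_add]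
    split_ifs with h
    · rw [Finset.sum_eq_single (y.1.degree, y.2.degree)]
      · simp
      · rintro ⟨a, b⟩ - hne
        rcases ne_or_eq y.1.degree a with ha | ha
        · simp [ha]
        · rcases ne_or_eq y.2.degree b with hb | hb
          · simp [hb]
          · exact absurd (by rw [ha, hb]) hne
      · intro h'
        exact absurd (Finset.HasAntidiagonal.mem_antidiagonal.2 h) h'
    · refine (Finset.sum_eq_zero ?_).symm
      rintro ⟨a, b⟩ hab
      rw [Finset.HasAntidiagonal.mem_antidiagonal] at hab
      rcases ne_or_eq y.1.degree a with ha | ha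
      · simp [ha]
      · rcases ne_or_eq y.2.degree b with hb | hb
        · simp [hb]
        · exact absurd (by rw [ha, hb, hab]) h

theorem homogeneousComponent_succ_linear_mul (d : ℕ) {a : Poly} (ha : a.IsHomogeneous 1)
    (p : Poly) :
    homogeneousComponent (d + 1) (a * p) = a * homogeneousComponent d p := by
  rw [homogeneousComponent_mul_eq_sum, Finset.sum_eq_single (1, d)]
  · rw [homogeneousComponent_of_mem ha, if_pos rfl]
  · rintro ⟨i, j⟩ hij hne
    have hi : i ≠ 1 := by
      rintro rfl
      apply hne
      rw [Finset.HasAntidiagonal.mem_antidiagonal] at hij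
      simp only at hij
      rw [Prod.mk.injEq]
      omega
    simp only
    rw [homogeneousComponent_of_mem ha, if_neg hi, zero_mul]
  · intro h
    exact absurd (Finset.HasAntidiagonal.mem_antidiagonal.2 (add_comm 1 d)) h

theorem homogeneousComponent_zero_linear_mul {a : Poly} (ha : a.IsHomogeneous 1) (p : Poly) :
    homogeneousComponent 0 (a * p) = 0 := by
  rw [homogeneousComponent_mul_eq_sum, Finset.HasAntidiagonal.antidiagonal_zero,
    Finset.sum_singleton, homogeneousComponent_of_mem ha, if_neg zero_ne_one, zero_mul]

theorem homogeneousComponent_one_eq (d : ℕ) :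
    homogeneousComponent d (1 : Poly) = if d = 0 then 1 else 0 :=
  homogeneousComponent_of_mem (isHomogeneous_one _ _)

/-- Expanding the product, a term that picks `A` from exactly `d` factors has degree `d`. -/
theorem homogeneousComponent_list_prod (L : List (Matrix (Fin 3) (Fin 3) Poly))
    (hL : ∀ A ∈ L, ∀ i j, (A i j).IsHomogeneous 1) (d : ℕ) (a b : Fin 3) :
    homogeneousComponent d (((L.map (1 + ·)).prod : Matrix (Fin 3) (Fin 3) Poly) a b) =
      elemList d L a b := by
  induction L generalizing d a b with
  | nil =>
    cases d with
    | zero =>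
      simp only [List.map_nil, List.prod_nil, elemList, Matrix.one_apply]
      split_ifs <;> simp
    | succ d =>
      simp only [List.map_nil, List.prod_nil, elemList, Matrix.one_apply, Matrix.zero_apply]
      split_ifs
      · simp [homogeneousComponent_one_eq]
      · simp
  | cons A L ih =>
    have hA := hL A List.mem_cons_self
    have ih := ih fun A' hA' => hL A' (List.mem_cons_of_mem _ hA')
    simp only [List.map_cons, List.prod_cons, add_mul, one_mul, Matrix.add_apply, map_add, ih]
    cases d with
    | zero =>
      simp only [elemList, Matrix.mul_apply, map_sum]
      rw [Finset.sum_eq_zero fun k _ => homogeneousComponent_zero_linear_mul (hA a k) _, add_zero]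
    | succ d =>
      simp only [elemList, Matrix.mul_apply, map_sum, Matrix.add_apply]
      rw [add_comm, Finset.sum_congr rfl fun k _ =>
        homogeneousComponent_succ_linear_mul d (hA a k) _]
      simp only [ih]

theorem IsLinearProduct.exists_elemList {m : ℕ} {f : Poly}
    (h : IsLinearProduct m (Matrix.transvection 0 1 f)) :
    ∃ L : List (Matrix (Fin 3) (Fin 3) Poly), L.length = m ∧
      (∀ A ∈ L, ∀ i j, (A i j).IsHomogeneous 1) ∧
      ∀ d, elemList (d + 1) L = Matrix.single 0 1 (homogeneousComponent (d + 1) f) := by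
  obtain ⟨L, B, B', hlen, hL, -, hP⟩ := h
  refine ⟨L, hlen, hL, fun d => ?_⟩
  have key : ∀ d a b, homogeneousComponent d (Matrix.transvection 0 1 f a b) =
      (elemList d L * B.map (C : ℂ → Poly)) a b := fun d a b => by
    rw [hP]
    simp only [Matrix.mul_apply, map_sum, Matrix.map_apply]
    refine Finset.sum_congr rfl fun k _ => ?_
    rw [mul_comm, homogeneousComponent_C_mul, homogeneousComponent_list_prod L hL, mul_comm]
  -- The product of the factors `1 + A` has degree `0` part `1`, so the constant terms determine
  -- `B`.
  have hB : B.map (C : ℂ → Poly) = Matrix.transvection 0 1 (C (coeff 0 f)) := by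
    ext1 a b
    have := key 0 a b
    rw [elemList, one_mul, homogeneousComponent_zero] at this
    rw [← this]
    simp only [Matrix.transvection, Matrix.add_apply, Matrix.one_apply, Matrix.single_apply]
    split_ifs <;> simp
  have hd : Matrix.single 0 1 (homogeneousComponent (d + 1) f) =
      elemList (d + 1) L * B.map (C : ℂ → Poly) := by
    ext1 a b
    rw [← key]
    simp only [Matrix.transvection, Matrix.add_apply, Matrix.one_apply, Matrix.single_apply,
      map_add, apply_ite (homogeneousComponent (d + 1)), map_zero, homogeneousComponent_one_eq]
    split_ifs <;> simp_all
  have h01 : (0 : Fin 3) ≠ 1 := by decide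
  -- Cancel `B`: its inverse fixes `E₀₁` from the right because `E₀₁ E₀₁ = 0`.
  calc elemList (d + 1) L
      = elemList (d + 1) L * B.map (C : ℂ → Poly) *
          Matrix.transvection 0 1 (-C (coeff 0 f)) := by
        rw [hB, mul_assoc, Matrix.transvection_mul_transvection_same _ _ h01, add_neg_cancel,
          Matrix.transvection_zero, mul_one]
    _ = _ := by
        rw [← hd, Matrix.transvection, mul_add, mul_one,
          Matrix.single_mul_single_of_ne _ _ _ _ h01.symm, add_zero]

theorem homogeneousComponent_mem_linearSubstitutions {f : Poly} {ℓ m d : ℕ} (hf : f ∈ leavesLE ℓ)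
    (hm : 256 * ℓ ^ 11 ≤ m) (hd : d ≠ 0) :
    homogeneousComponent d f ∈ linearSubstitutions (nce3 m d) := by
  obtain ⟨F, hF, rfl⟩ := hf
  have hp : HasLinearProducts m F.eval := F.hasLinearProducts.mono
    ((Nat.mul_le_mul_left _ (Nat.pow_le_pow_left hF _)).trans hm)
  obtain ⟨L, rfl, hL, hE⟩ := (hp 0 1 (by decide)).1.exists_elemList
  obtain ⟨d, rfl⟩ := Nat.exists_eq_succ_of_ne_zero hd
  -- Decodes the variable index `k = 9 i + 3 a + b`. The default `0` only concerns variables that do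
  -- not occur in `nce3`.
  refine ⟨fun k => (L.getD (k / 9) 0 : Matrix (Fin 3) (Fin 3) Poly)
    (Fin.ofNat 3 (k % 9 / 3)) (Fin.ofNat 3 (k % 3)), fun k => ?_, ?_⟩
  · simp only [List.getD_eq_getElem?_getD]
    rcases h : L[k / 9]? with _ | A
    · exact isHomogeneous_zero _ _ _
    · exact hL A (List.mem_of_getElem? h) _ _
  · have hlist : (List.ofFn fun i : Fin L.length => (Matrix.of fun a b : Fin 3 =>
        (L.getD ((9 * (i : ℕ) + 3 * (a : ℕ) + b) / 9) 0 : Matrix (Fin 3) (Fin 3) Poly)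
          (Fin.ofNat 3 ((9 * (i : ℕ) + 3 * (a : ℕ) + b) % 9 / 3))
          (Fin.ofNat 3 ((9 * (i : ℕ) + 3 * (a : ℕ) + b) % 3)) :
          Matrix (Fin 3) (Fin 3) Poly)) = L := by
      refine List.ext_get (by simp) fun i h1 h2 => ?_
      ext1 a b
      have e1 : (9 * i + 3 * (a : ℕ) + b) / 9 = i := by omega
      have e2 : Fin.ofNat 3 ((9 * i + 3 * (a : ℕ) + b) % 9 / 3) = a := by
        ext
        simp only [Fin.ofNat]
        omega
      have e3 : Fin.ofNat 3 ((9 * i + 3 * (a : ℕ) + b) % 3) = b := by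
        ext
        simp only [Fin.ofNat]
        omega
      simp only [List.get_ofFn, Matrix.of_apply, Fin.val_cast, e1, e2, e3]
      simp [h2]
    rw [bind₁_nce3, hlist, hE]
    simp [Fin.sum_univ_three, Matrix.single_apply]

/-! ### Small formulas for the noncommutative elementary symmetric polynomials -/

theorem elemList_eq_zero {R : Type*} [Semiring R] {d : ℕ} {L : List R} (h : L.length < d) :
    elemList d L = 0 := by
  induction L generalizing d with
  | nil =>
    cases d with
    | zero => exact absurd h (Nat.not_lt_zero _)
    | succ d => rfl
  | cons a L ih =>
    cases d with
    | zero => exact absurd h (Nat.not_lt_zero _)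
    | succ d =>
      rw [List.length_cons] at h
      rw [elemList, ih (by omega), ih (by omega), mul_zero, add_zero]

theorem list_prod_one_add_smul {R : Type*} [Ring R] [Algebra ℂ R] (t : ℂ) (L : List R) {N : ℕ}
    (hN : L.length < N) :
    (L.map fun A => 1 + t • A).prod = ∑ e ∈ Finset.range N, t ^ e • elemList e L := by
  induction L generalizing N with
  | nil =>
    rw [Finset.sum_eq_single_of_mem 0 (Finset.mem_range.2 hN)]
    · simp [elemList]
    · intro e _ he
      rw [elemList_eq_zero (by simpa using Nat.pos_of_ne_zero he), smul_zero]
  | cons A L ih =>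
    rw [List.length_cons] at hN
    obtain ⟨N, rfl⟩ := Nat.exists_eq_add_one_of_ne_zero (by omega : N ≠ 0)
    -- Two truncations of the same product: multiplication by `t • A` shifts degrees by one, so that
    -- term needs one summand fewer.
    have h1 : (L.map fun A => 1 + t • A).prod = ∑ e ∈ Finset.range N, t ^ e • elemList e L :=
      ih (by omega)
    have h2 : (L.map fun A => 1 + t • A).prod = ∑ e ∈ Finset.range (N + 1), t ^ e • elemList e L :=
      ih (by omega)
    rw [List.map_cons, List.prod_cons, add_mul, one_mul]
    nth_rewrite 1 [h2]
    rw [h1, Finset.sum_range_succ', Finset.sum_range_succ']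
    simp only [elemList, pow_zero, one_smul, smul_add, Finset.sum_add_distrib, smul_mul_assoc,
      Finset.mul_sum, mul_smul_comm, pow_succ, mul_smul]
    abel

theorem exists_interpolation_weights {N d : ℕ} (hd : d < N) :
    ∃ w : Fin N → ℂ, ∀ e < N, ∑ j : Fin N, w j * (j : ℂ) ^ e = if e = d then 1 else 0 := by
  let V : Matrix (Fin N) (Fin N) ℂ := Matrix.vandermonde fun j => ((j : ℕ) : ℂ)
  have hV : IsUnit V.det := by
    rw [isUnit_iff_ne_zero, Matrix.det_vandermonde_ne_zero_iff]
    exact Nat.cast_injective.comp Fin.val_injective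
  -- The weights are row `d` of the inverse Vandermonde matrix at the nodes `0, …, N - 1`.
  refine ⟨Matrix.vecMul (Pi.single ⟨d, hd⟩ 1) V⁻¹, fun e he => ?_⟩
  have h : Matrix.vecMul (Matrix.vecMul (Pi.single ⟨d, hd⟩ 1) V⁻¹) V = Pi.single ⟨d, hd⟩ 1 := by
    rw [Matrix.vecMul_vecMul, Matrix.nonsing_inv_mul _ hV, Matrix.vecMul_one]
  have h' := congrFun h ⟨e, he⟩
  rw [Pi.single_apply] at h'
  simpa [Matrix.vecMul, dotProduct, V, Matrix.vandermonde_apply, Fin.ext_iff] using h'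

theorem elemList_eq_sum_interpolation {R : Type*} [Ring R] [Algebra ℂ R] {N d : ℕ} (hd : d < N) :
    ∃ w : Fin N → ℂ, ∀ L : List R, L.length < N →
      elemList d L = ∑ j : Fin N, w j • (L.map fun A => 1 + (j : ℂ) • A).prod := by
  obtain ⟨w, hw⟩ := exists_interpolation_weights hd
  refine ⟨w, fun L hL => ?_⟩
  simp only [fun t : ℂ => list_prod_one_add_smul t L hL, Finset.smul_sum, smul_smul]
  rw [Finset.sum_comm]
  simp only [← Finset.sum_smul]
  rw [Finset.sum_congr rfl fun e he => by rw [hw e (Finset.mem_range.1 he)]]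
  simp [hd]

/-- Halve the product: an entry is a sum of 3 products of two entries of the halves, a factor 6 per
level. -/
theorem list_prod_mem_leavesLE (k : ℕ) (L : List (Matrix (Fin 3) (Fin 3) Poly))
    (hL : ∀ A ∈ L, ∀ i j, (A i j).totalDegree ≤ 1) (hk : L.length ≤ 2 ^ k) (i j : Fin 3) :
    L.prod i j ∈ leavesLE (6 ^ k) := by
  induction k generalizing L i j with
  | zero =>
    match L, hk with
    | [], _ =>
      rw [List.prod_nil, Matrix.one_apply]
      split_ifs
      · exact one_mem_leavesLE le_rfl
      · exact zero_mem_leavesLE le_rfl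
    | [A], _ =>
      rw [List.prod_singleton]
      exact leaf_mem_leavesLE (hL A List.mem_cons_self i j) le_rfl
    | _ :: _ :: _, h => simp at h
  | succ k ih =>
    rw [← List.take_append_drop (2 ^ k) L, List.prod_append, Matrix.mul_apply]
    have h1 := fun a b => ih (L.take (2 ^ k)) (fun A hA => hL A (List.mem_of_mem_take hA))
      (by simp) a b
    have h2 := fun a b => ih (L.drop (2 ^ k)) (fun A hA => hL A (List.mem_of_mem_drop hA))
      (by rw [List.length_drop, pow_succ] at *; omega) a b
    have h3 : 6 ^ (k + 1) = 3 * (6 ^ k + 6 ^ k) := by ring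
    rw [h3]
    refine sum_mem_leavesLE _ _ (fun r _ => mul_mem_leavesLE (h1 i r) (h2 r j)) (by simp)
      (by norm_num) ?_
    have := Nat.one_le_pow k 6 (by norm_num)
    omega

theorem totalDegree_one_add_smul_le (A : Matrix (Fin 3) (Fin 3) Poly)
    (hA : ∀ i j, (A i j).totalDegree ≤ 1) (t : ℂ) (i j : Fin 3) :
    ((1 + t • A) i j).totalDegree ≤ 1 := by
  rw [Matrix.add_apply, Matrix.smul_apply, Matrix.one_apply]
  refine (totalDegree_add _ _).trans (max_le ?_ ((totalDegree_smul_le _ _).trans (hA i j)))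
  split_ifs <;> simp

theorem bind₁_nce3_mem_leavesLE (l : ℕ → Poly) (hl : ∀ i, (l i).totalDegree ≤ 1) (m d : ℕ) :
    bind₁ l (nce3 m d) ∈ leavesLE (81 * (m + 1) ^ 4) := by
  rw [bind₁_nce3]
  set L : List (Matrix (Fin 3) (Fin 3) Poly) := List.ofFn fun i : Fin m =>
      (Matrix.of fun a b : Fin 3 => l (9 * i + 3 * a + b) : Matrix (Fin 3) (Fin 3) Poly) with hLdef
  have hlen : L.length = m := by simp [hLdef]
  have hL : ∀ A ∈ L, ∀ i j, (A i j).totalDegree ≤ 1 := fun A hA i j => by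
    obtain ⟨k, rfl⟩ := List.mem_ofFn.1 hA
    exact hl _
  -- Chosen so that `m ≤ 2 ^ k ≤ 2 (m + 1)`, which keeps `6 ^ k ≤ 8 ^ k` cubic in `m + 1`.
  set k := Nat.log 2 m + 1 with hk
  have hk1 : m ≤ 2 ^ k := (Nat.lt_pow_succ_log_self one_lt_two m).le
  have hk2 : 2 ^ k ≤ 2 * (m + 1) := by
    rcases Nat.eq_zero_or_pos m with rfl | hm
    · simp [hk]
    · have := Nat.pow_log_le_self 2 hm.ne'
      rw [hk, pow_succ]
      omega
  have hk3 : 6 ^ k ≤ 8 * (m + 1) ^ 3 := by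
    calc 6 ^ k ≤ 8 ^ k := Nat.pow_le_pow_left (by norm_num) k
      _ = (2 ^ k) ^ 3 := by rw [← pow_mul, mul_comm, pow_mul]; norm_num
      _ ≤ (2 * (m + 1)) ^ 3 := Nat.pow_le_pow_left hk2 3
      _ = 8 * (m + 1) ^ 3 := by ring
  have hentry : ∀ a b, elemList d L a b ∈ leavesLE ((m + 1) * (1 + 6 ^ k)) := fun a b => by
    have hpos : 1 ≤ (m + 1) * (1 + 6 ^ k) := Nat.mul_pos (by omega) (by positivity)
    rcases Nat.lt_or_ge m d with h | h
    · rw [elemList_eq_zero (by omega)]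
      exact zero_mem_leavesLE hpos
    · obtain ⟨w, hw⟩ := elemList_eq_sum_interpolation (R := Matrix (Fin 3) (Fin 3) Poly)
        (Nat.lt_succ_of_le h)
      rw [hw L (by omega), Matrix.sum_apply]
      refine sum_mem_leavesLE _ _ (fun j _ => ?_) (by simp) (by omega) (Nat.le_add_right _ _)
      rw [Matrix.smul_apply, smul_eq_C_mul]
      refine mul_mem_leavesLE (C_mem_leavesLE _ le_rfl) (list_prod_mem_leavesLE k _ ?_ ?_ a b)
      · intro A hA
        obtain ⟨A', hA', rfl⟩ := List.mem_map.1 hA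
        exact totalDegree_one_add_smul_le A' (hL A' hA') _
      · rw [List.length_map, hlen]
        exact hk1
  have hpos : 1 ≤ (m + 1) * (1 + 6 ^ k) := Nat.mul_pos (by omega) (by positivity)
  refine leavesLE_mono ?_ (sum_mem_leavesLE _ _ (fun a _ => sum_mem_leavesLE _ _
    (fun b _ => hentry a b) (N := 3) (by simp) (by norm_num) hpos) (N := 3) (by simp) (by norm_num)
    (Nat.mul_pos (by norm_num) hpos))
  have h1 : (m + 1) * 6 ^ k ≤ (m + 1) * (8 * (m + 1) ^ 3) := Nat.mul_le_mul_left _ hk3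
  have h2 : (m + 1) * 1 ≤ (m + 1) * (m + 1) ^ 3 :=
    Nat.mul_le_mul_left _ (Nat.one_le_pow _ _ (by omega))
  calc 3 * (3 * ((m + 1) * (1 + 6 ^ k))) = 9 * ((m + 1) * 1) + 9 * ((m + 1) * 6 ^ k) := by ring
    _ ≤ 9 * ((m + 1) * (m + 1) ^ 3) + 9 * ((m + 1) * (8 * (m + 1) ^ 3)) := by omega
    _ = 81 * (m + 1) ^ 4 := by ring

/-! ### Formulas for the homogeneous components of circuits -/

/-- Sequences of polynomials that are computed by circuits: every entry is affine linear, or the sum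
or product of two earlier entries. -/
def IsStraightLine {s : ℕ} (v : Fin s → Poly) : Prop :=
  ∀ i, (v i).totalDegree ≤ 1 ∨ (∃ j < i, ∃ k < i, v i = v j + v k) ∨
    ∃ j < i, ∃ k < i, v i = v j * v k

theorem Circuit.val_snoc_castSucc {n : ℕ} (C : Circuit n) (g : Gate n) (i : Fin n) :
    (C.snoc g).val i.castSucc = C.val i := by
  rw [Circuit.val, Fin.snoc_castSucc]

theorem Circuit.val_snoc_last {n : ℕ} (C : Circuit n) (g : Gate n) :
    (C.snoc g).val (Fin.last n) = g.eval C.val := by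
  rw [Circuit.val, Fin.snoc_last]

theorem Circuit.isStraightLine {n : ℕ} (C : Circuit n) : IsStraightLine C.val := by
  induction C with
  | nil => exact fun i => i.elim0
  | @snoc n C g ih =>
    intro i
    induction i using Fin.lastCases with
    | last =>
      rw [Circuit.val_snoc_last]
      cases g with
      | input l hl => exact Or.inl hl
      | add j k =>
        exact Or.inr (Or.inl ⟨j.castSucc, Fin.castSucc_lt_last j, k.castSucc,
          Fin.castSucc_lt_last k, by rw [val_snoc_castSucc, val_snoc_castSucc]; rfl⟩)
      | mul j k =>
        exact Or.inr (Or.inr ⟨j.castSucc, Fin.castSucc_lt_last j, k.castSucc,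
          Fin.castSucc_lt_last k, by rw [val_snoc_castSucc, val_snoc_castSucc]; rfl⟩)
    | cast i =>
      rw [Circuit.val_snoc_castSucc]
      rcases ih i with h | ⟨j, hj, k, hk, h⟩ | ⟨j, hj, k, hk, h⟩
      · exact Or.inl h
      · exact Or.inr (Or.inl ⟨j.castSucc, hj, k.castSucc, hk, by simpa [val_snoc_castSucc] using h⟩)
      · exact Or.inr (Or.inr ⟨j.castSucc, hj, k.castSucc, hk, by simpa [val_snoc_castSucc] using h⟩)

/-! ### Triangular linear systems solved by repeated squaring -/

section TriangularSystem

variable {ι : Type*} [Fintype ι] [DecidableEq ι]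

theorem pow_apply_eq_zero_of_triangular {N : Matrix ι ι Poly} {rk : ι → ℕ}
    (hN : ∀ x y, N x y ≠ 0 → rk y < rk x) (r : ℕ) {x y : ι} (h : (N ^ r) x y ≠ 0) :
    rk y + r ≤ rk x := by
  induction r generalizing y with
  | zero =>
    rw [pow_zero, Matrix.one_apply] at h
    have : x = y := by
      by_contra hne
      exact h (if_neg hne)
    rw [this, add_zero]
  | succ r ih =>
    rw [pow_succ, Matrix.mul_apply] at h
    obtain ⟨z, -, hz⟩ := Finset.exists_ne_zero_of_sum_ne_zero h
    have h1 := ih (left_ne_zero_of_mul hz)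
    have h2 := hN z y (right_ne_zero_of_mul hz)
    omega

/-- Iterating `y = N y + c` gives `y = N^(2^t) y + G c` with `G = 1 + N + ⋯ + N^(2^t - 1)`. Doubling
the number of terms replaces `G` by `N^(2^t) G + G` and multiplies the leaf bound by only `4 W`. -/
theorem exists_truncated_inverse {N : Matrix ι ι Poly} {y c : ι → Poly} {T W : ℕ}
    (hy : y = N.mulVec y + c) (hT : 1 ≤ T) (hW : Fintype.card ι ≤ W) (hW1 : 1 ≤ W)
    (hN : ∀ x z, N x z ∈ leavesLE T) (t : ℕ) :
    (∀ x z, (N ^ 2 ^ t) x z ∈ leavesLE ((4 * W) ^ t * T)) ∧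
    ∃ G : Matrix ι ι Poly, (∀ x z, G x z ∈ leavesLE ((4 * W) ^ t * T)) ∧
      y = (N ^ 2 ^ t).mulVec y + G.mulVec c := by
  induction t with
  | zero =>
    refine ⟨by simpa using hN, 1, fun x z => ?_, by simpa using hy⟩
    rw [Matrix.one_apply]
    split_ifs
    · exact one_mem_leavesLE (by simpa using hT)
    · exact zero_mem_leavesLE (by simpa using hT)
  | succ t ih =>
    obtain ⟨h1, G, hG, hyG⟩ := ih
    set P := N ^ 2 ^ t with hP
    set b := (4 * W) ^ t * T with hb
    have hbpos : 1 ≤ b := Nat.mul_pos (by positivity) hT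
    have hbs : (4 * W) ^ (t + 1) * T = 4 * (W * b) := by rw [hb, pow_succ]; ring
    have hWb : b ≤ W * b := Nat.le_mul_of_pos_left b hW1
    have hPP : N ^ 2 ^ (t + 1) = P * P := by rw [hP, ← pow_add, pow_succ]; ring_nf
    have hmul : ∀ Q : Matrix ι ι Poly, (∀ x z, Q x z ∈ leavesLE b) →
        ∀ x z, (P * Q) x z ∈ leavesLE (2 * (W * b)) := fun Q hQ x z => by
      rw [Matrix.mul_apply]
      refine leavesLE_mono (le_of_eq ?_) (sum_mem_leavesLE _ _
        (fun r _ => mul_mem_leavesLE (h1 x r) (hQ r z)) hW hW1 (by omega))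
      ring
    rw [hbs, hPP]
    refine ⟨fun x z => leavesLE_mono (by omega) (hmul P h1 x z), P * G + G, fun x z => ?_, ?_⟩
    · rw [Matrix.add_apply]
      exact leavesLE_mono (by omega) (add_mem_leavesLE (hmul G hG x z) (hG x z))
    · rw [Matrix.add_mulVec, ← Matrix.mulVec_mulVec, ← Matrix.mulVec_mulVec, ← add_assoc,
        ← Matrix.mulVec_add, ← hyG]
      exact hyG

/-- Each application of `N` lowers the rank, so `N ^ 2 ^ t = 0` and only `G c` remains. -/
theorem mem_leavesLE_of_triangular_system {N : Matrix ι ι Poly} {y c : ι → Poly} {T U W t : ℕ}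
    (hy : y = N.mulVec y + c) (hT : 1 ≤ T) (hW : Fintype.card ι ≤ W) (hW1 : 1 ≤ W)
    (hN : ∀ x z, N x z ∈ leavesLE T) (hU : 1 ≤ U) (hc : ∀ x, c x ∈ leavesLE U) {rk : ι → ℕ}
    (htri : ∀ x z, N x z ≠ 0 → rk z < rk x) (hrk : ∀ x, rk x < 2 ^ t) (x : ι) :
    y x ∈ leavesLE (W * ((4 * W) ^ t * T + U)) := by
  obtain ⟨-, G, hG, hyG⟩ := exists_truncated_inverse hy hT hW hW1 hN t
  have h0 : N ^ 2 ^ t = 0 := by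
    ext1 a b
    by_contra h
    have := pow_apply_eq_zero_of_triangular htri _ h
    have := hrk a
    omega
  rw [hyG, h0, Matrix.zero_mulVec, zero_add]
  exact sum_mem_leavesLE _ _ (fun z _ => mul_mem_leavesLE (hG x z) (hc z)) hW hW1 (by omega)

end TriangularSystem

theorem sum_prod_ite_eq_sum_range {s d e D : ℕ} (he : e ≤ d) (j : Fin s) (q : ℕ → Poly) :
    ∑ x : Fin s × Fin (d + 1), (if x.1 = j ∧ D < (x.2 : ℕ) ∧ (x.2 : ℕ) ≤ e then q x.2 else 0) =
      ∑ a ∈ Finset.range (e + 1), if D < a then q a else 0 := by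
  rw [Fintype.sum_prod_type, Finset.sum_eq_single j]
  · simp only [true_and]
    rw [Fin.sum_univ_eq_sum_range (fun a => if D < a ∧ a ≤ e then q a else 0) (d + 1)]
    symm
    refine (Finset.sum_congr rfl fun a ha => ?_).trans
      (Finset.sum_subset (Finset.range_subset_range.2 (by omega)) fun a _ ha => ?_)
    · have : a ≤ e := Nat.lt_succ_iff.1 (Finset.mem_range.1 ha)
      simp [this]
    · have : ¬ a ≤ e := fun h => ha (Finset.mem_range.2 (by omega))
      simp [this]
  · intro i _ hi
    simp [hi]
  · simp

/-- Since `e ≤ 2 * D`, at most one factor of each term has degree above `D`. Hence products are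
linear in the components of high degree. -/
theorem homogeneousComponent_mul_split {e D : ℕ} (he : e ≤ 2 * D) (p q : Poly) :
    homogeneousComponent e (p * q) =
      (∑ a ∈ Finset.range (e + 1), if D < a then
          homogeneousComponent (e - a) q * homogeneousComponent a p else 0) +
      (∑ a ∈ Finset.range (e + 1), if D < a then
          homogeneousComponent (e - a) p * homogeneousComponent a q else 0) +
      ∑ a ∈ Finset.range (e + 1), if a ≤ D ∧ e - a ≤ D then
          homogeneousComponent a p * homogeneousComponent (e - a) q else 0 := by
  rw [homogeneousComponent_mul_eq_sum, Finset.Nat.sum_antidiagonal_eq_sum_range_succ_mk]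
  have h2 : (∑ a ∈ Finset.range (e + 1), if D < a then
      homogeneousComponent (e - a) p * homogeneousComponent a q else 0) =
      ∑ a ∈ Finset.range (e + 1), if D < e - a then
        homogeneousComponent a p * homogeneousComponent (e - a) q else 0 := by
    rw [← Finset.sum_range_reflect]
    refine Finset.sum_congr rfl fun a ha => ?_
    have ha : a ≤ e := Nat.lt_succ_iff.1 (Finset.mem_range.1 ha)
    have h3 : e + 1 - 1 - a = e - a := by omega
    have h4 : e - (e - a) = a := by omega
    rw [h3, h4]
  rw [h2, ← Finset.sum_add_distrib, ← Finset.sum_add_distrib]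
  refine Finset.sum_congr rfl fun a ha => ?_
  have ha : a ≤ e := Nat.lt_succ_iff.1 (Finset.mem_range.1 ha)
  rcases Nat.lt_or_ge D a with h | h
  · rw [if_pos h, if_neg (by omega), if_neg (by omega), add_zero, add_zero, mul_comm]
  · rw [if_neg (by omega)]
    rcases Nat.lt_or_ge D (e - a) with h' | h'
    · rw [if_pos h', if_neg (by omega), add_zero, zero_add]
    · rw [if_neg (by omega), if_pos ⟨h, h'⟩, zero_add, zero_add]

/-- The components of degree at most `2 * D` satisfy a triangular linear system whose coefficients
are simple expressions in the components of degree at most `D`. -/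
theorem IsStraightLine.exists_row {s : ℕ} {v : Fin s → Poly} (hv : IsStraightLine v) {d D T : ℕ}
    (hD : 1 ≤ D) (hT : 1 ≤ T)
    (hlow : ∀ i, ∀ e ≤ D, e ≤ d → homogeneousComponent e (v i) ∈ leavesLE T)
    (i : Fin s) (e : ℕ) (hed : e ≤ d) (heD : e ≤ 2 * D) {y : Fin s × Fin (d + 1) → Poly}
    (hy : ∀ j (a : Fin (d + 1)), (a : ℕ) ≤ 2 * D → y (j, a) = homogeneousComponent (a : ℕ) (v j)) :
    ∃ (r : Fin s × Fin (d + 1) → Poly) (c : Poly),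
      homogeneousComponent e (v i) = ∑ x, r x * y x + c ∧ (∀ x, r x ∈ leavesLE (2 * T)) ∧
      (∀ x, r x ≠ 0 → x.1 < i) ∧ c ∈ leavesLE ((d + 1) * (2 * T)) := by
  have hT2 : 1 ≤ 2 * T := by omega
  have hdT : T ≤ (d + 1) * (2 * T) := by nlinarith
  rcases Nat.lt_or_ge D e with hDe | hDe
  · rcases hv i with h | ⟨j, hj, k, hk, h⟩ | ⟨j, hj, k, hk, h⟩
    -- An affine linear gate has no component of degree `e > D ≥ 1`.
    · refine ⟨0, 0, ?_, fun x => zero_mem_leavesLE hT2, fun x hx => absurd rfl hx,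
        zero_mem_leavesLE (by omega)⟩
      simp [homogeneousComponent_eq_zero e (v i) (by omega)]
    · let e' : Fin (d + 1) := ⟨e, by omega⟩
      refine ⟨fun x => (if x = (j, e') then 1 else 0) + if x = (k, e') then 1 else 0, 0, ?_,
        fun x => ?_, fun x hx => ?_, zero_mem_leavesLE (by omega)⟩
      · simp [add_mul, Finset.sum_add_distrib, h, hy j e' heD, hy k e' heD, e']
      · rw [two_mul]
        refine add_mem_leavesLE ?_ ?_ <;> split_ifs <;>
          first | exact one_mem_leavesLE hT | exact zero_mem_leavesLE hT
      · by_cases h1 : x = (j, e')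
        · rw [h1]; exact hj
        · by_cases h2 : x = (k, e')
          · rw [h2]; exact hk
          · exact absurd (by simp [h1, h2]) hx
    · refine ⟨fun x =>
        (if x.1 = j ∧ D < (x.2 : ℕ) ∧ (x.2 : ℕ) ≤ e then
          homogeneousComponent (e - x.2) (v k) else 0) +
        (if x.1 = k ∧ D < (x.2 : ℕ) ∧ (x.2 : ℕ) ≤ e then
          homogeneousComponent (e - x.2) (v j) else 0),
        ∑ a ∈ Finset.range (e + 1), if a ≤ D ∧ e - a ≤ D then
          homogeneousComponent a (v j) * homogeneousComponent (e - a) (v k) else 0,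
        ?_, fun x => ?_, fun x hx => ?_, ?_⟩
      · rw [h, homogeneousComponent_mul_split heD]
        congr 1
        rw [← sum_prod_ite_eq_sum_range hed j
            fun a => homogeneousComponent (e - a) (v k) * homogeneousComponent a (v j),
          ← sum_prod_ite_eq_sum_range hed k
            fun a => homogeneousComponent (e - a) (v j) * homogeneousComponent a (v k),
          ← Finset.sum_add_distrib]
        refine Finset.sum_congr rfl fun x _ => ?_
        rw [add_mul, ite_mul, ite_mul, zero_mul]
        congr 1
        · refine ite_congr rfl (fun hx => ?_) fun _ => rfl
          rw [← hy j x.2 (by omega), ← hx.1]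
        · refine ite_congr rfl (fun hx => ?_) fun _ => rfl
          rw [← hy k x.2 (by omega), ← hx.1]
      · rw [two_mul]
        refine add_mem_leavesLE ?_ ?_ <;> split_ifs with hx <;>
          first | exact hlow _ _ (by omega) (by omega) | exact zero_mem_leavesLE hT
      · by_cases h1 : x.1 = j
        · rw [h1]; exact hj
        · by_cases h2 : x.1 = k
          · rw [h2]; exact hk
          · exact absurd (by simp [h1, h2]) hx
      · refine sum_mem_leavesLE _ _ (fun a ha => ?_) (by rw [Finset.card_range]; omega)
          (by omega) hT2
        have ha : a ≤ e := Nat.lt_succ_iff.1 (Finset.mem_range.1 ha)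
        split_ifs with hx
        · rw [two_mul]
          exact mul_mem_leavesLE (hlow _ _ hx.1 (by omega)) (hlow _ _ hx.2 (by omega))
        · exact zero_mem_leavesLE hT2
  · exact ⟨0, homogeneousComponent e (v i), by simp, fun x => zero_mem_leavesLE hT2,
      fun x hx => absurd rfl hx, leavesLE_mono hdT (hlow i e hDe hed)⟩

/-- The unknowns are indexed by gate and degree, and the rank of an unknown is the position of its
gate, so `2 ^ t ≥ s` suffices. -/
theorem IsStraightLine.homogeneousComponent_double {s : ℕ} {v : Fin s → Poly}
    (hv : IsStraightLine v) {d D T W t : ℕ} (hD : 1 ≤ D) (hT : 1 ≤ T) (hW : s * (d + 1) ≤ W)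
    (hs : s ≤ 2 ^ t)
    (hlow : ∀ i, ∀ e ≤ D, e ≤ d → homogeneousComponent e (v i) ∈ leavesLE T)
    (i : Fin s) (e : ℕ) (heD : e ≤ 2 * D) (hed : e ≤ d) :
    homogeneousComponent e (v i) ∈ leavesLE ((4 * W) ^ (t + 2) * T) := by
  -- Unknowns of degree above `2 * D` are set to `0`, so that the index type does not depend on `D`.
  let y : Fin s × Fin (d + 1) → Poly := fun x =>
    if (x.2 : ℕ) ≤ 2 * D then homogeneousComponent (x.2 : ℕ) (v x.1) else 0
  have hy : ∀ j (a : Fin (d + 1)), (a : ℕ) ≤ 2 * D →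
      y (j, a) = homogeneousComponent (a : ℕ) (v j) := fun j a ha => if_pos ha
  have hrow : ∀ x : Fin s × Fin (d + 1), ∃ (r : Fin s × Fin (d + 1) → Poly) (c : Poly),
      y x = ∑ z, r z * y z + c ∧ (∀ z, r z ∈ leavesLE (2 * T)) ∧
      (∀ z, r z ≠ 0 → z.1 < x.1) ∧ c ∈ leavesLE ((d + 1) * (2 * T)) := fun x => by
    by_cases hx : (x.2 : ℕ) ≤ 2 * D
    · have := hv.exists_row hD hT hlow x.1 x.2 (by omega) hx hy
      rwa [← hy x.1 x.2 hx] at this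
    · refine ⟨0, 0, by simp [y, hx], fun z => zero_mem_leavesLE (by omega),
        fun z hz => absurd rfl hz, zero_mem_leavesLE (Nat.mul_pos (by omega) (by omega))⟩
  choose N c h1 h2 h3 h4 using hrow
  have hs1 : 1 ≤ s := i.pos
  have hdW : d + 1 ≤ W := (Nat.le_mul_of_pos_left _ hs1).trans hW
  have hmem := mem_leavesLE_of_triangular_system (N := Matrix.of N) (y := y) (c := c) (T := 2 * T)
    (U := (d + 1) * (2 * T)) (W := W) (t := t) (funext h1) (by omega) (by simpa using hW) (by omega)
    h2 (Nat.mul_pos (by omega) (by omega)) h4 (rk := fun x => (x.1 : ℕ)) h3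
    (fun x => x.1.is_lt.trans_le hs) (i, ⟨e, by omega⟩)
  rw [hy i ⟨e, by omega⟩ heD] at hmem
  refine leavesLE_mono ?_ hmem
  have hX : 1 ≤ (4 * W) ^ t := Nat.one_le_pow _ _ (by omega)
  calc W * ((4 * W) ^ t * (2 * T) + (d + 1) * (2 * T))
      ≤ W * ((4 * W) ^ t * W * (2 * T) + (4 * W) ^ t * W * (2 * T)) := by
        gcongr
        · exact Nat.le_mul_of_pos_right _ (by omega)
        · exact hdW.trans (Nat.le_mul_of_pos_left _ hX)
    _ = 4 * ((4 * W) ^ t * W ^ 2 * T) := by ring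
    _ ≤ 16 * ((4 * W) ^ t * W ^ 2 * T) := by omega
    _ = (4 * W) ^ (t + 2) * T := by ring

/-- Degrees at most `1` are leaves; `⌈log₂ d⌉` degree doublings reach `d`. -/
theorem homogeneousComponent_mem_leavesLE_of_circuit {s d : ℕ} {p : Poly}
    (hp : p ∈ circuitSizeLE s) :
    homogeneousComponent d p ∈
      leavesLE (((4 * (s * (d + 1))) ^ (Nat.clog 2 s + 2)) ^ Nat.clog 2 d) := by
  obtain ⟨n, hn, C, i, rfl⟩ := hp
  have hs1 : 1 ≤ s := i.pos.trans_le hn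
  have key : ∀ k, ∀ i, ∀ e ≤ 2 ^ k, e ≤ d → homogeneousComponent e (C.val i) ∈
      leavesLE (((4 * (s * (d + 1))) ^ (Nat.clog 2 s + 2)) ^ k) := fun k => by
    induction k with
    | zero =>
      intro i e he _
      have he1 : e ≤ 1 := by simpa using he
      exact leaf_mem_leavesLE
        ((homogeneousComponent_isHomogeneous e _).totalDegree_le.trans he1) (by simp)
    | succ k ih =>
      intro i e he hed
      rw [pow_succ'] at he ⊢
      exact C.isStraightLine.homogeneousComponent_double Nat.one_le_two_pow
        (Nat.one_le_pow _ _ (by positivity)) (Nat.mul_le_mul_right _ hn)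
        (hn.trans (Nat.le_pow_clog one_lt_two s)) ih i e he hed
  exact key _ i d (Nat.le_pow_clog one_lt_two d) le_rfl

/-! ### Formulas are circuits -/

theorem Circuit.range_val_subset_snoc {n : ℕ} (C : Circuit n) (g : Gate n) :
    Set.range C.val ⊆ Set.range (C.snoc g).val := by
  rintro _ ⟨i, rfl⟩
  exact ⟨i.castSucc, C.val_snoc_castSucc g i⟩

/-- Extending an arbitrary circuit `C` lets the gates of the second subformula be appended to those
of the first. -/
theorem Formula.exists_circuit (F : Formula) {n : ℕ} (C : Circuit n) :
    ∃ m ≤ n + F.size, ∃ C' : Circuit m,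
      Set.range C.val ⊆ Set.range C'.val ∧ F.eval ∈ Set.range C'.val := by
  induction F generalizing n with
  | leaf l hl =>
    exact ⟨n + 1, le_rfl, C.snoc (.input l hl), C.range_val_subset_snoc _,
      Fin.last n, C.val_snoc_last _⟩
  | add F G hF hG =>
    obtain ⟨m₁, h₁, C₁, hC₁, hF₁⟩ := hF C
    obtain ⟨m₂, h₂, C₂, hC₂, i, hi⟩ := hG C₁
    obtain ⟨j, hj⟩ := hC₂ hF₁
    refine ⟨m₂ + 1, by rw [Formula.size]; omega, C₂.snoc (.add j i),
      hC₁.trans (hC₂.trans (C₂.range_val_subset_snoc _)), Fin.last m₂, ?_⟩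
    rw [C₂.val_snoc_last, Gate.eval, hi, hj, Formula.eval]
  | mul F G hF hG =>
    obtain ⟨m₁, h₁, C₁, hC₁, hF₁⟩ := hF C
    obtain ⟨m₂, h₂, C₂, hC₂, i, hi⟩ := hG C₁
    obtain ⟨j, hj⟩ := hC₂ hF₁
    refine ⟨m₂ + 1, by rw [Formula.size]; omega, C₂.snoc (.mul j i),
      hC₁.trans (hC₂.trans (C₂.range_val_subset_snoc _)), Fin.last m₂, ?_⟩
    rw [C₂.val_snoc_last, Gate.eval, hi, hj, Formula.eval]

theorem formulaSizeLE_subset_circuitSizeLE (s : ℕ) : formulaSizeLE s ⊆ circuitSizeLE s := by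
  rintro p ⟨F, hF, rfl⟩
  obtain ⟨m, hm, C, -, i, hi⟩ := F.exists_circuit Circuit.nil
  exact ⟨m, by omega, C, i, hi⟩

/-! ### Formulas are permanents -/

/-- The matrix `M` bordered by a row with entry `y` in column `q`, a column with entry `x` in row
`p`, and the corner entry `c`, all other new entries being `z`. -/
def bordered {n α : Type*} [DecidableEq n] (M : Matrix n n α) (p q : n) (x y c z : α) :
    Matrix (Option n) (Option n) α
  | none, none => c
  | some i, none => if i = p then x else z
  | none, some j => if j = q then y else z
  | some i, some j => M i j

theorem bordered_none_none {n α : Type*} [DecidableEq n] (M : Matrix n n α) (p q : n)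
    (x y c z : α) : bordered M p q x y c z none none = c := rfl

theorem bordered_some_none {n α : Type*} [DecidableEq n] (M : Matrix n n α) (p q : n)
    (x y c z : α) (i : n) : bordered M p q x y c z (some i) none = if i = p then x else z := rfl

theorem bordered_none_some {n α : Type*} [DecidableEq n] (M : Matrix n n α) (p q : n)
    (x y c z : α) (j : n) : bordered M p q x y c z none (some j) = if j = q then y else z := rfl

theorem bordered_some_some {n α : Type*} [DecidableEq n] (M : Matrix n n α) (p q : n)
    (x y c z : α) (i j : n) : bordered M p q x y c z (some i) (some j) = M i j := rfl

/-- A permutation either fixes the new index, contributing a term of the permanent of `M`, or uses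
both `x` and `y`, contributing `x * y` times a term with row `p` and column `q` deleted. Together
this adds `x * y` to the entry `(p, q)`. -/
theorem permanent_bordered {n R : Type*} [Fintype n] [DecidableEq n] [CommSemiring R]
    (M : Matrix n n R) (p q : n) (x y : R) :
    (bordered M p q x y 1 0).permanent =
      (Matrix.of fun i j => M i j + if i = p ∧ j = q then x * y else 0).permanent := by
  unfold Matrix.permanent
  rw [← (Equiv.Perm.decomposeOption (α := n)).symm.sum_comp, Fintype.sum_prod_type,
    Fintype.sum_option, Finset.sum_eq_single p]
  · rw [← Finset.sum_add_distrib]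
    refine Finset.sum_congr rfl fun e _ => ?_
    simp only [Fintype.prod_option, Equiv.Perm.decomposeOption_symm_apply, Equiv.Perm.mul_apply,
      Equiv.optionCongr_apply, Option.map_none, Option.map_some, Equiv.swap_self,
      Equiv.refl_apply, Equiv.swap_apply_left, bordered_none_none, bordered_some_none,
      bordered_some_some, one_mul, if_true, Matrix.of_apply]
    -- For fixed `e` the two cases differ only in the column `e.symm p`, which the second sends to
    -- the new row.
    rw [← Finset.mul_prod_erase _ _ (Finset.mem_univ (e.symm p)),
      ← Finset.mul_prod_erase _ (fun j => bordered M p q x y 1 0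
        (Equiv.swap none (some p) (some (e j))) (some j)) (Finset.mem_univ (e.symm p)),
      ← Finset.mul_prod_erase _ (fun j => M (e j) j + if e j = p ∧ j = q then x * y else 0)
        (Finset.mem_univ (e.symm p))]
    have h1 : ∏ j ∈ Finset.univ.erase (e.symm p), bordered M p q x y 1 0
        (Equiv.swap none (some p) (some (e j))) (some j) =
        ∏ j ∈ Finset.univ.erase (e.symm p), M (e j) j := Finset.prod_congr rfl fun j hj => by
      have hne : e j ≠ p := fun h => Finset.ne_of_mem_erase hj (by rw [← h, e.symm_apply_apply])
      rw [Equiv.swap_apply_of_ne_of_ne (by simp) (by simpa using hne), bordered_some_some]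
    have h2 : ∏ j ∈ Finset.univ.erase (e.symm p),
        (M (e j) j + if e j = p ∧ j = q then x * y else 0) =
        ∏ j ∈ Finset.univ.erase (e.symm p), M (e j) j := Finset.prod_congr rfl fun j hj => by
      have hne : e j ≠ p := fun h => Finset.ne_of_mem_erase hj (by rw [← h, e.symm_apply_apply])
      rw [if_neg (fun h => hne h.1), add_zero]
    rw [h1, h2]
    simp only [Equiv.apply_symm_apply, Equiv.swap_apply_right, bordered_none_some, true_and]
    split_ifs <;> ring
  · intro a _ ha
    refine Finset.sum_eq_zero fun e _ => Finset.prod_eq_zero (Finset.mem_univ none) ?_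
    simp [bordered, ha]
  · simp

theorem permanent_submatrix_equiv {m n R : Type*} [Fintype m] [DecidableEq m] [Fintype n]
    [DecidableEq n] [CommSemiring R] (e : m ≃ n) (M : Matrix n n R) :
    (M.submatrix e e).permanent = M.permanent := by
  unfold Matrix.permanent
  refine Fintype.sum_equiv (Equiv.permCongr e) _ _ fun σ => ?_
  refine Fintype.prod_equiv e _ _ fun i => ?_
  simp [Equiv.permCongr_apply]

theorem permanent_mem_permanentSizeLE {n : Type*} [Fintype n] [DecidableEq n]
    (M : Matrix n n Poly) (hM : ∀ i j, (M i j).totalDegree ≤ 1) {s : ℕ} (hs : Fintype.card n ≤ s) :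
    M.permanent ∈ permanentSizeLE s := by
  refine ⟨Fintype.card n, hs, M.submatrix (Fintype.equivFin n).symm (Fintype.equivFin n).symm,
    fun i j => hM _ _, ?_⟩
  rw [permanent_submatrix_equiv]

/-- Sums are `G + H * 1` and products `0 + G * H`, so both gates fit the bordering identity. `leaves
- 1` counts gates, and exactly one disappears. -/
theorem Formula.eq_leaf_or_eval_eq (F : Formula) : (∃ l hl, F = .leaf l hl) ∨
    ∃ G H K : Formula, F.eval = G.eval + H.eval * K.eval ∧
      G.leaves - 1 + (H.leaves - 1) + (K.leaves - 1) + 1 = F.leaves - 1 := by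
  cases F with
  | leaf l hl => exact Or.inl ⟨l, hl, rfl⟩
  | add G H =>
    refine Or.inr ⟨G, H, .const 1, by simp [Formula.eval, Formula.const], ?_⟩
    have := G.leaves_pos
    have := H.leaves_pos
    simp only [Formula.leaves, Formula.const]
    omega
  | mul G H =>
    refine Or.inr ⟨.const 0, G, H, by simp [Formula.eval, Formula.const], ?_⟩
    have := G.leaves_pos
    have := H.leaves_pos
    simp only [Formula.leaves, Formula.const]
    omega

/-- Matrices of formulas, by induction on the total number `τ` of gates: bordering trades one gate
for one new row and column. -/
theorem permanent_formula_mem_permanentSizeLE (τ : ℕ) {n : Type} [Fintype n] [DecidableEq n]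
    (F : Matrix n n Formula) (hF : ∑ i, ∑ j, ((F i j).leaves - 1) = τ) :
    (F.map Formula.eval).permanent ∈ permanentSizeLE (Fintype.card n + τ) := by
  induction τ generalizing n with
  | zero =>
    refine permanent_mem_permanentSizeLE _ (fun i j => ?_) le_rfl
    have h : (F i j).leaves - 1 = 0 := by
      simp only [Finset.sum_eq_zero_iff, Finset.mem_univ, true_imp_iff] at hF
      exact hF i j
    rw [Matrix.map_apply]
    rcases (F i j).eq_leaf_or_eval_eq with ⟨l, hl, e⟩ | ⟨G, H, K, -, e⟩
    · rw [e, Formula.eval]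
      exact hl
    · omega
  | succ τ ih =>
    obtain ⟨p, q, hpq⟩ : ∃ p q, (F p q).leaves - 1 ≠ 0 := by
      by_contra! h
      simp [h] at hF
    rcases (F p q).eq_leaf_or_eval_eq with ⟨l, hl, e⟩ | ⟨G, H, K, hev, e⟩
    · simp [e, Formula.leaves] at hpq
    · let F' : Matrix n n Formula := Matrix.of fun i j => if i = p ∧ j = q then G else F i j
      have hc0 : (Formula.const 0).leaves - 1 = 0 := rfl
      have hc1 : (Formula.const 1).leaves - 1 = 0 := rfl
      have hsum : ∑ i, ∑ j, ((F' i j).leaves - 1) + (F p q).leaves - 1 =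
          ∑ i, ∑ j, ((F i j).leaves - 1) + (G.leaves - 1) := by
        have h1 : ∀ f : n → n → ℕ, ∑ i, ∑ j, f i j =
            f p q + ∑ x ∈ Finset.univ.erase (p, q), f x.1 x.2 := fun f => by
          rw [← Fintype.sum_prod_type', ← Finset.add_sum_erase _ _ (Finset.mem_univ (p, q))]
        rw [h1, h1 fun i j => (F i j).leaves - 1]
        have h2 : ∑ x ∈ Finset.univ.erase (p, q), ((F' x.1 x.2).leaves - 1) =
            ∑ x ∈ Finset.univ.erase (p, q), ((F x.1 x.2).leaves - 1) :=
          Finset.sum_congr rfl fun x hx => by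
            have hne : ¬ (x.1 = p ∧ x.2 = q) := fun h =>
              Finset.ne_of_mem_erase hx (Prod.ext h.1 h.2)
            simp [F', hne]
        have h3 : F' p q = G := by simp [F']
        rw [h2, h3]
        omega
      have := ih (bordered F' p q H K (.const 1) (.const 0)) (by
        simp only [Fintype.sum_option, bordered, apply_ite Formula.leaves, apply_ite (· - 1), hc0,
          hc1, Finset.sum_add_distrib, Finset.sum_ite_eq', Finset.mem_univ, if_true]
        omega)
      rw [Fintype.card_option, add_assoc, add_comm 1 τ] at this
      convert! this using 1
      have hmap : (bordered F' p q H K (.const 1) (.const 0)).map Formula.eval =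
          bordered (F'.map Formula.eval) p q H.eval K.eval 1 0 := by
        ext1 i j
        cases i <;> cases j <;>
          simp [bordered, Formula.const, Formula.eval, apply_ite Formula.eval]
      rw [hmap, permanent_bordered]
      congr 1
      ext1 i j
      by_cases h : i = p ∧ j = q
      · obtain ⟨rfl, rfl⟩ := h
        simp [F', hev]
      · simp [F', h]

theorem formulaSizeLE_subset_permanentSizeLE (s : ℕ) : formulaSizeLE s ⊆ permanentSizeLE s := by
  rintro p ⟨F, hF, rfl⟩
  have h := permanent_formula_mem_permanentSizeLE (F.leaves - 1)
    (Matrix.of fun _ _ : Unit => F) (by simp)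
  have hpos := F.leaves_pos
  have hsize := F.size_add_one
  obtain ⟨n, hn, M, hM, e⟩ := h
  refine ⟨n, ?_, M, hM, ?_⟩
  · rw [Fintype.card_unit] at hn
    omega
  · rw [← e, Matrix.permanent_unique]
    rfl

/-! ### The family of permanents -/

theorem per_isHomogeneous (n : ℕ) : (per n).IsHomogeneous n := by
  unfold per Matrix.permanent
  refine IsHomogeneous.sum _ _ _ fun σ _ => ?_
  have h := IsHomogeneous.prod (R := ℂ) Finset.univ
    (fun i : Fin n => (X (Nat.pair (σ i) i) : Poly)) (fun _ => 1) fun i _ => isHomogeneous_X _ _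
  simpa using h

theorem card_vars_per_le (n : ℕ) : (per n).vars.card ≤ n * n := by
  classical
  let S : Finset ℕ := Finset.univ.image fun x : Fin n × Fin n => Nat.pair x.1 x.2
  have h : per n ∈ supported ℂ (S : Set ℕ) := by
    unfold per Matrix.permanent
    refine sum_mem fun σ _ => prod_mem fun i _ => ?_
    exact Algebra.subset_adjoin ⟨_, by simp [S], rfl⟩
  have h2 : (per n).vars ⊆ S := by exact_mod_cast mem_supported.1 h
  calc (per n).vars.card ≤ S.card := Finset.card_le_card h2
    _ ≤ Fintype.card (Fin n × Fin n) := Finset.card_image_le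
    _ = n * n := by simp

theorem per_mem_VNP : per ∈ VNP := by
  have hid : (fun n => n) ∈ PolyBounded :=
    PolyBounded.of_le_eval Polynomial.X fun n => by simp
  refine ⟨⟨?_, ?_⟩, fun n => n, hid, fun n => ?_⟩
  · exact PolyBounded.of_le_eval Polynomial.X fun n => by
      simpa using (per_isHomogeneous n).totalDegree_le
  · exact PolyBounded.of_le_eval (Polynomial.X * Polynomial.X) fun n => by
      simpa using card_vars_per_le n
  · exact ⟨n, le_rfl, Matrix.of fun i j : Fin n => (X (Nat.pair i j) : Poly),
      fun i j => (totalDegree_X _).le, rfl⟩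

/-! ### Limits -/

theorem subset_limits (S : Set Poly) : S ⊆ limits S := fun p hp =>
  ⟨fun _ => p, fun _ => hp, ⟨p.support, fun _ => subset_rfl⟩, fun _ => tendsto_const_nhds⟩

/-- On polynomials with monomials in a fixed finite set, a linear map is a finite combination of
coefficients, hence continuous. -/
theorem map_mem_limits (φ : Poly →ₗ[ℂ] Poly) {S T : Set Poly} (h : ∀ q ∈ S, φ q ∈ T) {p : Poly}
    (hp : p ∈ limits S) : φ p ∈ limits T := by
  classical
  obtain ⟨u, hu, ⟨M, hM⟩, hlim⟩ := hp
  have hpM : p.support ⊆ M := fun e he => by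
    by_contra hne
    have h0 : ∀ k, coeff e (u k) = 0 := fun k => by
      by_contra hc
      exact hne (hM k (mem_support_iff.2 hc))
    have h1 := hlim e
    simp only [h0] at h1
    exact mem_support_iff.1 he (tendsto_nhds_unique h1 tendsto_const_nhds)
  have hφ : ∀ q : Poly, q.support ⊆ M → φ q = ∑ e ∈ M, coeff e q • φ (monomial e 1) :=
      fun q hq => by
    nth_rewrite 1 [q.as_sum]
    rw [map_sum, Finset.sum_subset hq fun e _ he => by simp [notMem_support_iff.1 he]]
    refine Finset.sum_congr rfl fun e _ => ?_
    rw [← map_smul, smul_monomial, smul_eq_mul, mul_one]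
  refine ⟨fun k => φ (u k), fun k => h _ (hu k),
    ⟨M.biUnion fun e => (φ (monomial e 1)).support, fun k => ?_⟩, fun e => ?_⟩
  · simp only
    rw [hφ _ (hM k)]
    exact support_sum.trans (Finset.biUnion_mono fun e _ => support_smul)
  · simp only
    rw [hφ p hpM]
    simp only [hφ _ (hM _), coeff_sum, coeff_smul]
    exact tendsto_finsetSum _ fun e' _ => (hlim e').smul_const _

/-! ### Comparison of the classes with the reductions -/

theorem formulaSizeLE_subset_leavesLE (s : ℕ) : formulaSizeLE s ⊆ leavesLE s := by
  rintro p ⟨F, hF, rfl⟩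
  have h1 := F.size_add_one
  have h2 := F.leaves_pos
  exact ⟨F, by omega, rfl⟩

theorem nce3_zero_ne_zero (m : ℕ) : nce3 m 0 ≠ 0 := by
  have h : nce3 m 0 = 3 := by
    simp only [nce3, ncElem_zero, Fin.sum_univ_three, Matrix.one_apply]
    norm_num [Fin.ext_iff]
  intro h0
  have h1 := congrArg constantCoeff (h.symm.trans h0)
  rw [map_ofNat, map_zero] at h1
  exact three_ne_zero h1

theorem elemList_succ_replicate_zero {R : Type*} [Semiring R] (m d : ℕ) :
    elemList (d + 1) (List.replicate m (0 : R)) = 0 := by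
  induction m with
  | zero => rfl
  | succ m ih => rw [List.replicate_succ, elemList, ih, zero_mul, add_zero]

theorem zero_mem_linearSubstitutions_nce3 (m : ℕ) {d : ℕ} (hd : d ≠ 0) :
    0 ∈ linearSubstitutions (nce3 m d) := by
  refine ⟨0, fun i => isHomogeneous_zero _ _ _, ?_⟩
  obtain ⟨d, rfl⟩ := Nat.exists_eq_succ_of_ne_zero hd
  have h0 : (Matrix.of fun _ _ : Fin 3 => (0 : Poly)) = 0 := rfl
  simp only [bind₁_nce3, Pi.zero_apply, h0, List.ofFn_const, Nat.succ_eq_add_one,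
    elemList_succ_replicate_zero, Matrix.zero_apply, Finset.sum_const_zero]

theorem totalDegree_bind₁_le_one {a : ℕ → Poly} (ha : ∀ i, (a i).totalDegree ≤ 1) {l : Poly}
    (hl : l.IsHomogeneous 1) : (bind₁ a l).totalDegree ≤ 1 := by
  have h : l ∈ homogeneousSubmodule ℕ ℂ 1 := hl
  rw [homogeneousSubmodule_one_eq_span_X] at h
  clear hl
  induction h using Submodule.span_induction with
  | mem x hx =>
    obtain ⟨i, rfl⟩ := hx
    rw [bind₁_X_right]
    exact ha i
  | zero => simp
  | add x y _ _ hx hy =>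
    rw [map_add]
    exact (totalDegree_add _ _).trans (max_le hx hy)
  | smul c x _ hx =>
    rw [map_smul]
    exact (totalDegree_smul_le _ _).trans hx

theorem exists_bind₁_per_eq_permanent {r : ℕ} (M : Matrix (Fin r) (Fin r) Poly)
    (hM : ∀ i j, (M i j).totalDegree ≤ 1) :
    ∃ a : ℕ → Poly, (∀ k, (a k).totalDegree ≤ 1) ∧ bind₁ a (per r) = M.permanent := by
  refine ⟨fun k => if h : k.unpair.1 < r ∧ k.unpair.2 < r then
    M ⟨k.unpair.1, h.1⟩ ⟨k.unpair.2, h.2⟩ else 0, fun k => ?_, ?_⟩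
  · simp only
    split_ifs
    · exact hM _ _
    · simp
  · simp [per, Matrix.permanent, map_sum, map_prod]

/-- The argument common to all four items, with `cl` the identity or `limits`. In `hupper` only
degree `n` of the `n`-th member matters, because `per n` is homogeneous of degree `n`. -/
theorem VNP_subset_complexityClass_iff {B : Set (ℕ → ℕ)} {K : ℕ → Set Poly}
    {cl : Set Poly → Set Poly}
    (hmap : ∀ (φ : Poly →ₗ[ℂ] Poly) (S T : Set Poly), (∀ q ∈ S, φ q ∈ T) → ∀ p ∈ cl S, φ p ∈ cl T)
    (hsub : ∀ S, S ⊆ cl S)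
    (hcomp : ∀ s ∈ PolyBounded, ∀ m ∈ B, ∃ M ∈ B, ∀ n, ∀ r ≤ s n, m r ≤ M n)
    (hpow : ∀ c ∈ B, ∀ a k : ℕ, (fun n => a * (c n + 1) ^ k) ∈ B)
    (hupper : ∀ s ∈ B, ∃ m ∈ B, ∀ n ≠ 0, ∀ p ∈ K (s n),
      homogeneousComponent n p ∈ linearSubstitutions (nce3 (m n) n))
    (hlower : ∀ s, formulaSizeLE s ⊆ K s) :
    VNP ⊆ complexityClass B (fun s => cl (K s)) ↔
      Reduces B (fun d p q => (d = 0 ∧ q ≠ 0) ∨ p ∈ cl (linearSubstitutions q)) (graded per)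
        nce3 := by
  constructor
  · intro h
    obtain ⟨-, s, hs, hper⟩ := h per_mem_VNP
    obtain ⟨m, hm, hmn⟩ := hupper s hs
    refine ⟨m, hm, fun n d => ?_⟩
    rcases eq_or_ne d 0 with rfl | hd
    · exact Or.inl ⟨rfl, nce3_zero_ne_zero _⟩
    · right
      rcases eq_or_ne d n with rfl | hdn
      · exact hmap (homogeneousComponent d) _ _ (fun q hq => hmn d hd q hq) _ (hper d)
      · rw [graded, homogeneousComponent_of_mem (per_isHomogeneous n), if_neg hdn]
        exact hsub _ (zero_mem_linearSubstitutions_nce3 _ hd)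
  · rintro ⟨m, hm, hred⟩ f ⟨hf, s, hs, hperm⟩
    -- The matrix size `r` for `f n` is known only up to `r ≤ s n`, so a bound on all these `m r` is
    -- needed.
    obtain ⟨M, hM, hMr⟩ := hcomp s hs m hm
    refine ⟨hf, _, hpow M hM 162 4, fun n => ?_⟩
    obtain ⟨r, hr, A, hA, hfA⟩ := hperm n
    have hle : ∀ k ≤ M n, leavesLE (81 * (k + 1) ^ 4) ⊆ K (162 * (M n + 1) ^ 4) := fun k hk => by
      refine (leavesLE_mono ?_).trans ((leavesLE_subset_formulaSizeLE (81 * (M n + 1) ^ 4)).trans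
        ((hlower _).trans_eq (congrArg K (by ring))))
      gcongr
    rw [hfA]
    -- In degree `0` the reduction holds by convention and carries no information; the empty
    -- permanent is `1`.
    rcases eq_or_ne r 0 with rfl | hr0
    · rw [Matrix.permanent_isEmpty]
      exact hsub _ (hle 0 (Nat.zero_le _) (one_mem_leavesLE (by norm_num)))
    · obtain ⟨a, ha, hbind⟩ := exists_bind₁_per_eq_permanent A hA
      have hper : per r ∈ cl (linearSubstitutions (nce3 (m r) r)) := by
        have h := (hred r r).resolve_left fun h => hr0 h.1
        rwa [graded, homogeneousComponent_of_mem (per_isHomogeneous r), if_pos rfl] at h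
      rw [← hbind]
      refine hmap (bind₁ a).toLinearMap _ _ (fun q hq => ?_) _ hper
      obtain ⟨l, hl, rfl⟩ := hq
      rw [AlgHom.toLinearMap_apply, bind₁_bind₁]
      exact hle _ (hMr n r hr)
        (bind₁_nce3_mem_leavesLE _ (fun i => totalDegree_bind₁_le_one ha (hl i)) _ _)

theorem formula_upper_bound {s : ℕ → ℕ} (hs : s ∈ PolyBounded) :
    ∃ m ∈ PolyBounded, ∀ n ≠ 0, ∀ p ∈ formulaSizeLE (s n),
      homogeneousComponent n p ∈ linearSubstitutions (nce3 (m n) n) :=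
  ⟨_, PolyBounded.mul_add_one_pow hs 256 11, fun n hn _ hp =>
    homogeneousComponent_mem_linearSubstitutions
      (leavesLE_mono (Nat.le_succ _) (formulaSizeLE_subset_leavesLE (s n) hp)) le_rfl hn⟩

theorem circuit_upper_bound {s : ℕ → ℕ} (hs : s ∈ QuasiPolyBounded) :
    ∃ m ∈ QuasiPolyBounded, ∀ n ≠ 0, ∀ p ∈ circuitSizeLE (s n),
      homogeneousComponent n p ∈ linearSubstitutions (nce3 (m n) n) := by
  obtain ⟨k, hk⟩ := QuasiPolyBounded.exists_le_two_pow hs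
  refine ⟨fun n => 256 *
    (((4 * (s n * (n + 1))) ^ (Nat.clog 2 (s n) + 2)) ^ Nat.clog 2 n) ^ 11, ?_,
    fun n hn p hp => ?_⟩
  swap
  -- The formula computes the component itself, and taking its degree `n` component once more
  -- changes nothing.
  · have h := homogeneousComponent_mem_linearSubstitutions
      (homogeneousComponent_mem_leavesLE_of_circuit (d := n) hp) le_rfl hn
    rwa [homogeneousComponent_of_mem (homogeneousComponent_isHomogeneous n p), if_pos rfl] at h
  refine QuasiPolyBounded.of_le_two_pow_eval (8 + (2 + (Polynomial.X ^ k + Polynomial.X)) *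
    (Polynomial.X ^ k + 2) * Polynomial.X * 11) fun n hn => ?_
  simp only [Polynomial.eval_add, Polynomial.eval_mul, Polynomial.eval_pow, Polynomial.eval_X,
    Polynomial.eval_ofNat]
  set lam := Nat.log 2 n + 2 with hlam
  have h1 : s n ≤ 2 ^ lam ^ k := hk n hn
  have h2 : Nat.clog 2 (s n) ≤ lam ^ k := Nat.clog_le_of_le_pow h1
  have h3 : n + 1 ≤ 2 ^ lam := by
    have h := Nat.lt_pow_succ_log_self one_lt_two n
    exact Nat.le_trans h (Nat.pow_le_pow_right two_pos (Nat.le_succ _))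
  have h4 : Nat.clog 2 n ≤ lam := Nat.clog_le_of_le_pow ((Nat.le_succ n).trans h3)
  have h5 : 4 * (s n * (n + 1)) ≤ 2 ^ (2 + (lam ^ k + lam)) := by
    rw [pow_add, pow_add 2 (lam ^ k)]
    exact Nat.mul_le_mul_left _ (Nat.mul_le_mul h1 h3)
  have h6 : (4 * (s n * (n + 1))) ^ (Nat.clog 2 (s n) + 2) ≤
      2 ^ ((2 + (lam ^ k + lam)) * (lam ^ k + 2)) := by
    rw [pow_mul]
    exact (Nat.pow_le_pow_left h5 _).trans
      (Nat.pow_le_pow_right (by positivity) (Nat.add_le_add_right h2 2))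
  have h7 : ((4 * (s n * (n + 1))) ^ (Nat.clog 2 (s n) + 2)) ^ Nat.clog 2 n ≤
      2 ^ ((2 + (lam ^ k + lam)) * (lam ^ k + 2) * lam) := by
    rw [pow_mul _ _ lam]
    exact (Nat.pow_le_pow_left h6 _).trans (Nat.pow_le_pow_right (by positivity) h4)
  rw [pow_add 2 8, pow_mul _ _ 11]
  exact Nat.mul_le_mul_left _ (Nat.pow_le_pow_left h7 _)

theorem VF_subset_VNP : VF ⊆ VNP := fun _ ⟨hf, s, hs, h⟩ =>
  ⟨hf, s, hs, fun n => formulaSizeLE_subset_permanentSizeLE _ (h n)⟩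

end AlgComplexity

/-! ### The four equivalences -/

theorem mainTheorem1 :
    (AlgComplexity.VNP = AlgComplexity.VF ↔
      AlgComplexity.PHomLin (AlgComplexity.graded AlgComplexity.per) AlgComplexity.nce3) ∧
    (AlgComplexity.VNP ⊆ AlgComplexity.VFBar ↔
      AlgComplexity.BorderPHomLin (AlgComplexity.graded AlgComplexity.per) AlgComplexity.nce3) ∧
    (AlgComplexity.VNP ⊆ AlgComplexity.VQP ↔
      AlgComplexity.QPHomLin (AlgComplexity.graded AlgComplexity.per) AlgComplexity.nce3) ∧
    (AlgComplexity.VNP ⊆ AlgComplexity.VQPBar ↔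
      AlgComplexity.BorderQPHomLin (AlgComplexity.graded AlgComplexity.per) AlgComplexity.nce3) := by
  refine ⟨?_, ?_, ?_, ?_⟩
  · rw [subset_antisymm_iff, and_iff_left AlgComplexity.VF_subset_VNP]
    exact AlgComplexity.VNP_subset_complexityClass_iff (cl := fun S => S)
      (fun _ _ _ h p hp => h p hp)
      (fun _ => subset_rfl)
      (fun _ hs _ hm => AlgComplexity.PolyBounded.exists_comp_le hs hm)
      (fun _ hc => AlgComplexity.PolyBounded.mul_add_one_pow hc)
      (fun _ hs => AlgComplexity.formula_upper_bound hs)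
      fun _ => subset_rfl
  · exact AlgComplexity.VNP_subset_complexityClass_iff (cl := AlgComplexity.limits)
      (fun φ _ _ h _ hp => AlgComplexity.map_mem_limits φ h hp)
      AlgComplexity.subset_limits
      (fun _ hs _ hm => AlgComplexity.PolyBounded.exists_comp_le hs hm)
      (fun _ hc => AlgComplexity.PolyBounded.mul_add_one_pow hc)
      (fun _ hs => AlgComplexity.formula_upper_bound hs)
      fun _ => subset_rfl
  · exact AlgComplexity.VNP_subset_complexityClass_iff (cl := fun S => S)
      (fun _ _ _ h p hp => h p hp)
      (fun _ => subset_rfl)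
      (fun _ hs _ hm => AlgComplexity.QuasiPolyBounded.exists_comp_le hs hm)
      (fun _ hc => AlgComplexity.QuasiPolyBounded.mul_add_one_pow hc)
      (fun _ hs => AlgComplexity.circuit_upper_bound hs)
      AlgComplexity.formulaSizeLE_subset_circuitSizeLE
  · exact AlgComplexity.VNP_subset_complexityClass_iff (cl := AlgComplexity.limits)
      (fun φ _ _ h _ hp => AlgComplexity.map_mem_limits φ h hp)
      AlgComplexity.subset_limits
      (fun _ hs _ hm => AlgComplexity.QuasiPolyBounded.exists_comp_le hs hm)
      (fun _ hc => AlgComplexity.QuasiPolyBounded.mul_add_one_pow hc)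
      (fun _ hs => AlgComplexity.circuit_upper_bound hs)
      AlgComplexity.formulaSizeLE_subset_circuitSizeLE
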